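/- Let $n\in\mathbb N$, $T>0$, $\alpha\in(0,1)$, and let $\|\cdot\|$, $\langle\cdot,\cdot\rangle$ be the Euclidean norm and inner product on $\mathbb R^n$. **Spaces.** For $\beta>0$ let $(I^\beta\psi)(\tau)=\frac1{\Gamma(\beta)}\int_0^\tau\frac{\psi(\xi)}{(\tau-\xi)^{1-\beta}}\,d\xi$. For $t\in[0,T]$ let $AC^\alpha([0,t],\mathbb R^n)\subset C([0,t],\mathbb R^n)$ be the set of functions $x(\cdot)=x(0)+(I^\alpha\psi)(\cdot)$ with $\psi\in L^\infty([0,t],\mathbb R^n)$. For $x(\cdot)\in AC^\alpha([0,T],\mathbb R^n)$ let $({}^CD^\alpha x)(\tau)=\frac{d}{d\tau}\bigl(I^{1-\alpha}(x(\cdot)-x(0))\bigr)(\tau)$ (defined for a.e. $\tau$), and let $x_t(\cdot)$ be the restriction of $x(\cdot)$ to $[0,t]$. Let $G_n$ be the set of pairs $(t,w(\cdot))$ with $t\in[0,T]$, $w(\cdot)\in C([0,t],\mathbb R^n)$, with the metric $\max\{d^*((t,w),(t',w')),\,d^*((t',w'),(t,w))\}$, where $$d^*((t,w),(t',w'))=\max_{\tau\in[0,t]}\min_{\tau'\in[0,t']}\sqrt{|\tau-\tau'|^2+\|w(\tau)-w'(\tau')\|^2}.$$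 Let $G_n^\alpha=\{(t,w(\cdot))\in G_n: w(\cdot)\in AC^\alpha([0,t],\mathbb R^n)\}$ with the same metric, and $G_n^{\alpha\circ}=\{(t,w(\cdot))\in G_n^\alpha: t<T\}$. For $(t_0,w_0(\cdot))\in G_n^\alpha$ let $X^\alpha(t_0,w_0(\cdot))$ be the set of $x(\cdot)\in AC^\alpha([0,T],\mathbb R^n)$ with $x_{t_0}(\cdot)=w_0(\cdot)$. **Data.** Let $H:[0,T]\times\mathbb R^n\times\mathbb R^n\to\mathbb R$ be continuous, let $c_H>0$ satisfy $|H(t,x,s)-H(t,x,s')|\le c_H(1+\|x\|)\|s-s'\|$ for all $t,x,s,s'$, and suppose that for every $R\ge0$ there is $\lambda_H>0$ with $|H(t,x,s)-H(t,x',s)|\le\lambda_H(1+\|s\|)\|x-x'\|$ for all $t,s$ and all $x,x'$ with $\|x\|,\|x'\|\le R$. Let $\sigma:AC^\alpha([0,T],\mathbb R^n)\to\mathbb R$ be continuous in the maximum norm. **ci-derivatives.** A functional $\varphi:G_n^\alpha\to\mathbb R$ is $ci$-differentiable of order $\alpha$ at $(t_0,w_0(\cdot))\in G_n^{\alpha\circ}$,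 with $ci$-derivatives $\partial_t^\alpha\varphi(t_0,w_0(\cdot))\in\mathbb R$ and $\nabla^\alpha\varphi(t_0,w_0(\cdot))\in\mathbb R^n$, if for every $x(\cdot)\in X^\alpha(t_0,w_0(\cdot))$, as $t\to t_0+0$, $$\varphi(t,x_t(\cdot))-\varphi(t_0,w_0(\cdot))=\partial_t^\alpha\varphi(t_0,w_0(\cdot))(t-t_0)+\int_{t_0}^t\langle\nabla^\alpha\varphi(t_0,w_0(\cdot)),({}^CD^\alpha x)(\tau)\rangle\,d\tau+o(t-t_0).$$ **Minimax solutions.** Let $E(t,x,s)=\{(f,h)\in\mathbb R^n\times\mathbb R:\ \|f\|\le c_H(1+\|x\|),\ h=\langle s,f\rangle-H(t,x,s)\}$. For $(t_0,w_0(\cdot))\in G_n^\alpha$ and $s\in\mathbb R^n$ let $CH(t_0,w_0(\cdot),0,s)$ be the set of pairs $(x(\cdot),z(\cdot))$ such that $x(\cdot)\in X^\alpha(t_0,w_0(\cdot))$, $z:[0,T]\to\mathbb R$ is Lipschitz with $z=0$ on $[0,t_0]$, and $(({}^CD^\alpha x)(t),\dot z(t))\in E(t,x(t),s)$ for a.e.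 $t\in[t_0,T]$. A functional $\varphi:G_n^\alpha\to\mathbb R$ is a minimax solution of the Cauchy problem $$\partial_t^\alpha\varphi(t,w(\cdot))+H\bigl(t,w(t),\nabla^\alpha\varphi(t,w(\cdot))\bigr)=0,\ (t,w(\cdot))\in G_n^{\alpha\circ};\qquad \varphi(T,w(\cdot))=\sigma(w(\cdot)),\ w(\cdot)\in AC^\alpha([0,T],\mathbb R^n),$$ if it is both an upper solution, i.e. $\varphi$ is lower semicontinuous, $\varphi(T,w(\cdot))\ge\sigma(w(\cdot))$ for all $w(\cdot)$, and for all $(t_0,w_0(\cdot))\in G_n^{\alpha\circ}$, $t\in(t_0,T]$, $s\in\mathbb R^n$, $\varepsilon>0$ there is $(x(\cdot),z(\cdot))\in CH(t_0,w_0(\cdot),0,s)$ with $\varphi(t,x_t(\cdot))-z(t)\le\varphi(t_0,w_0(\cdot))+\varepsilon$; and a lower solution, i.e. $\varphi$ is upper semicontinuous, $\varphi(T,w(\cdot))\le\sigma(w(\cdot))$ for all $w(\cdot)$, and for all such $(t_0,w_0(\cdot)),t,s,\varepsilon$ there is $(x(\cdot),z(\cdot))\in CH(t_0,w_0(\cdot),0,s)$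 with $\varphi(t,x_t(\cdot))-z(t)\ge\varphi(t_0,w_0(\cdot))-\varepsilon$. **Theorem.** If a minimax solution $\varphi$ of this problem is $ci$-differentiable of order $\alpha$ at some point $(t_0,w_0(\cdot))\in G_n^{\alpha\circ}$, then it satisfies the Hamilton–Jacobi equation at this point: $$\partial_t^\alpha\varphi(t_0,w_0(\cdot))+H\bigl(t_0,w_0(t_0),\nabla^\alpha\varphi(t_0,w_0(\cdot))\bigr)=0.$$ -/

import Mathlib

open MeasureTheory Set Filter Topology

noncomputable section

namespace FracHJ

/-- `ℝⁿ` with the Euclidean norm and inner product. -/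
abbrev Vec (n : ℕ) : Type := EuclideanSpace ℝ (Fin n)

/-- The left-sided Riemann–Liouville fractional integral `(I^β ψ)(τ)` of order `β > 0`. -/
def rlIntegral {n : ℕ} (β : ℝ) (ψ : ℝ → Vec n) (τ : ℝ) : Vec n :=
  (1 / Real.Gamma β) • ∫ ξ in (0 : ℝ)..τ, (1 / (τ - ξ) ^ (1 - β)) • ψ ξ

/-- `w ∈ AC^α([0, t], ℝⁿ)`, where `AC^α` is regarded as a subset of `C([0, t], ℝⁿ)`:
`w = w(0) + I^α ψ` on `[0, t]` for some measurable, essentially bounded `ψ`. -/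
def IsAC {n : ℕ} (α : ℝ) {t : ℝ} (ht : 0 ≤ t) (w : C(Icc (0 : ℝ) t, Vec n)) : Prop :=
  ∃ ψ : ℝ → Vec n, MemLp ψ ⊤ (volume.restrict (Icc (0 : ℝ) t)) ∧
    ∀ τ : Icc (0 : ℝ) t, w τ = w ⟨0, left_mem_Icc.2 ht⟩ + rlIntegral α ψ τ

/-- The Caputo derivative `(ᶜD^α x)(τ) = d/dτ (I^{1-α}(x(·) - x(0)))(τ)`, for `α ∈ (0, 1)`.
The values of `x` outside `[0, T]` (here the constant extension) do not matter for
`τ ∈ (0, T)`. -/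
def caputo {n : ℕ} {T : ℝ} (hT : 0 < T) (α : ℝ) (x : C(Icc (0 : ℝ) T, Vec n)) (τ : ℝ) : Vec n :=
  deriv (rlIntegral (1 - α)
    (fun ξ => IccExtend hT.le x ξ - x ⟨0, left_mem_Icc.2 hT.le⟩)) τ

/-- The set `G_n` of pairs `(t, w(·))` with `t ∈ [0, T]` and `w ∈ C([0, t], ℝⁿ)`. -/
structure Path (n : ℕ) (T : ℝ) where
  /-- the time `t` -/
  time : Icc (0 : ℝ) T
  /-- the function `w(·)` on `[0, t]` -/
  fn : C(Icc (0 : ℝ) (time : ℝ), Vec n)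

namespace Path

variable {n : ℕ} {T : ℝ}

instance (p : Path n T) : Nonempty (Icc (0 : ℝ) (p.time : ℝ)) :=
  ⟨⟨0, left_mem_Icc.2 p.time.2.1⟩⟩

/-- The Euclidean distance between the points `(τ, w(τ))` and `(τ', w'(τ'))` of the graphs. -/
def ptDist (p q : Path n T) (τ : Icc (0 : ℝ) (p.time : ℝ)) (τ' : Icc (0 : ℝ) (q.time : ℝ)) : ℝ :=
  Real.sqrt (|(τ : ℝ) - τ'| ^ 2 + ‖p.fn τ - q.fn τ'‖ ^ 2)

/-- The one-sided distance `dist*`. -/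
def distStar (p q : Path n T) : ℝ :=
  ⨆ τ : Icc (0 : ℝ) (p.time : ℝ), ⨅ τ' : Icc (0 : ℝ) (q.time : ℝ), ptDist p q τ τ'

theorem ptDist_nonneg (p q : Path n T) (τ τ') : 0 ≤ ptDist p q τ τ' := Real.sqrt_nonneg _

theorem ptDist_eq (p q : Path n T) (τ τ') :
    ptDist p q τ τ' = dist (WithLp.toLp 2 ((τ : ℝ), p.fn τ)) (WithLp.toLp 2 ((τ' : ℝ), q.fn τ')) := by
  rw [WithLp.prod_dist_eq_of_L2]
  simp [ptDist, dist_eq_norm]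

theorem ptDist_triangle (p q r : Path n T) (τ τ' τ'') :
    ptDist p r τ τ'' ≤ ptDist p q τ τ' + ptDist q r τ' τ'' := by
  simp only [ptDist_eq]
  exact dist_triangle _ _ _

theorem bddBelow_ptDist (p q : Path n T) (τ) : BddBelow (range (ptDist p q τ)) :=
  ⟨0, by rintro _ ⟨τ', rfl⟩; exact ptDist_nonneg _ _ _ _⟩

theorem bddAbove_ptDist (p q : Path n T) :
    BddAbove (range fun τ => ⨅ τ', ptDist p q τ τ') := by
  let c : Icc (0 : ℝ) (q.time : ℝ) := ⟨0, left_mem_Icc.2 q.time.2.1⟩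
  have hc : Continuous fun τ => ptDist p q τ c := by
    unfold ptDist
    fun_prop
  obtain ⟨M, hM⟩ := (isCompact_range hc).bddAbove
  refine ⟨M, ?_⟩
  rintro _ ⟨τ, rfl⟩
  exact (ciInf_le (bddBelow_ptDist p q τ) c).trans (hM ⟨τ, rfl⟩)

theorem distStar_self (p : Path n T) : distStar p p = 0 := by
  have h : ∀ τ, (⨅ τ', ptDist p p τ τ') = 0 := fun τ => by
    refine le_antisymm ((ciInf_le (bddBelow_ptDist p p τ) τ).trans_eq ?_)
      (le_ciInf fun τ' => ptDist_nonneg _ _ _ _)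
    simp [ptDist]
  simp [distStar, h]

theorem distStar_triangle (p q r : Path n T) : distStar p r ≤ distStar p q + distStar q r := by
  refine ciSup_le fun τ => ?_
  have key : ∀ τ', (⨅ τ'', ptDist p r τ τ'') - distStar q r ≤ ptDist p q τ τ' := fun τ' => by
    have h1 : (⨅ τ'', ptDist p r τ τ'') - ptDist p q τ τ' ≤ ⨅ τ'', ptDist q r τ' τ'' :=
      le_ciInf fun τ'' => by
        have := ciInf_le (bddBelow_ptDist p r τ) τ''
        have := ptDist_triangle p q r τ τ' τ''
        linarith
    have h2 : (⨅ τ'', ptDist q r τ' τ'') ≤ distStar q r := le_ciSup (bddAbove_ptDist q r) τ'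
    linarith
  have h3 := le_ciInf key
  have h4 : (⨅ τ', ptDist p q τ τ') ≤ distStar p q := le_ciSup (bddAbove_ptDist p q) τ
  linarith

/-- `G_n` is endowed with the distance `max {dist*(p, q), dist*(q, p)}`. -/
instance : PseudoMetricSpace (Path n T) where
  dist p q := max (distStar p q) (distStar q p)
  dist_self p := by simp [distStar_self]
  dist_comm p q := max_comm _ _
  dist_triangle p q r := by
    refine max_le ?_ ?_
    · exact (distStar_triangle p q r).trans (add_le_add (le_max_left _ _) (le_max_left _ _))
    · refine (distStar_triangle r q p).trans ?_
      rw [add_comm]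
      exact add_le_add (le_max_right _ _) (le_max_right _ _)

end Path

/-- The set `G_n^α` of `(t, w(·)) ∈ G_n` with `w ∈ AC^α([0, t], ℝⁿ)`; its topology is the one
induced from `G_n`. -/
abbrev ACPath (n : ℕ) (T α : ℝ) : Type :=
  {p : Path n T // IsAC α p.time.2.1 p.fn}

/-- The set `AC^α([0, T], ℝⁿ)`, as a subspace of `C([0, T], ℝⁿ)` with the maximum norm. -/
abbrev ACFun (n : ℕ) {T : ℝ} (hT : 0 < T) (α : ℝ) : Type :=
  {x : C(Icc (0 : ℝ) T, Vec n) // IsAC α hT.le x}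

section

variable {n : ℕ} {T : ℝ} {hT : 0 < T} {α : ℝ}

/-- The point `(t, x_t(·))` of `G_n^α`, where `x_t` is the restriction of `x` to `[0, t]`. -/
def ACFun.restr (x : ACFun n hT α) (t : Icc (0 : ℝ) T) : ACPath n T α :=
  ⟨⟨t, x.1.comp ⟨inclusion (Icc_subset_Icc_right t.2.2), continuous_inclusion _⟩⟩, by
    obtain ⟨ψ, hψ, h⟩ := x.2
    exact ⟨ψ, hψ.mono_measure (Measure.restrict_mono (Icc_subset_Icc_right t.2.2) le_rfl),
      fun τ => h (inclusion (Icc_subset_Icc_right t.2.2) τ)⟩⟩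

/-- The point `(T, x(·))` of `G_n^α`. -/
def ACFun.terminal (x : ACFun n hT α) : ACPath n T α :=
  ⟨⟨⟨T, right_mem_Icc.2 hT.le⟩, x.1⟩, x.2⟩

/-- The value `w(t)` for `p = (t, w(·))`. -/
def ACPath.endValue (p : ACPath n T α) : Vec n :=
  p.1.fn ⟨p.1.time, right_mem_Icc.2 p.1.time.2.1⟩

/-- `x` is an admissible extension of `w₀`, i.e. `x ∈ X^α(t₀, w₀(·))`. -/
def IsExtension (p : ACPath n T α) (x : ACFun n hT α) : Prop :=
  ∀ τ : Icc (0 : ℝ) (p.1.time : ℝ),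
    x.1 (inclusion (Icc_subset_Icc_right p.1.time.2.2) τ) = p.1.fn τ

/-- The functional `φ` is `ci`-differentiable of order `α` at `p = (t₀, w₀(·))`, and `a ∈ ℝ` and
`v ∈ ℝⁿ` are `ci`-derivatives `∂_t^α φ(t₀, w₀(·))` and `∇^α φ(t₀, w₀(·))`. -/
def HasCiDerivAt (hT : 0 < T) (φ : ACPath n T α → ℝ) (p : ACPath n T α) (a : ℝ) (v : Vec n) :
    Prop :=
  ∀ x : ACFun n hT α, IsExtension p x →
    (fun t : Icc (0 : ℝ) T =>
      φ (x.restr t) - φ p - a * ((t : ℝ) - p.1.time)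
        - ∫ τ in (p.1.time : ℝ)..(t : ℝ), inner ℝ v (caputo hT α x.1 τ))
      =o[𝓝[>] p.1.time] fun t : Icc (0 : ℝ) T => (t : ℝ) - p.1.time

/-- The set `E(t, x, s) ⊆ ℝⁿ × ℝ`, the right-hand side of the characteristic inclusion. -/
def charSet (cH : ℝ) (H : Icc (0 : ℝ) T → Vec n → Vec n → ℝ) (t : Icc (0 : ℝ) T) (x s : Vec n) :
    Set (Vec n × ℝ) :=
  {fh | ‖fh.1‖ ≤ cH * (1 + ‖x‖) ∧ fh.2 = inner ℝ s fh.1 - H t x s}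

/-- The set `CH(t₀, w₀(·), z₀, s)` of characteristics `(x(·), z(·))`: `x` is in `AC^α`, `z` is
Lipschitz on `[0, T]`, the initial condition holds on `[0, t₀]`, and
`((ᶜD^α x)(t), ż(t)) ∈ E(t, x(t), s)` for a.e. `t ∈ [t₀, T]`. -/
def characteristics (hT : 0 < T) (cH : ℝ) (H : Icc (0 : ℝ) T → Vec n → Vec n → ℝ)
    (p : ACPath n T α) (z₀ : ℝ) (s : Vec n) : Set (ACFun n hT α × C(Icc (0 : ℝ) T, ℝ)) :=
  {xz | IsExtension p xz.1 ∧ (∃ K, LipschitzWith K xz.2) ∧ (∀ t, t ≤ p.1.time → xz.2 t = z₀) ∧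
    ∀ᵐ t : ℝ, ∀ ht : t ∈ Icc (0 : ℝ) T, (p.1.time : ℝ) ≤ t →
      (caputo hT α xz.1.1 t, deriv (IccExtend hT.le xz.2) t)
        ∈ charSet cH H ⟨t, ht⟩ (xz.1.1 ⟨t, ht⟩) s}

/-- `φ` is an upper solution of the Cauchy problem. -/
structure IsUpperSolution (hT : 0 < T) (cH : ℝ) (H : Icc (0 : ℝ) T → Vec n → Vec n → ℝ)
    (σ : ACFun n hT α → ℝ) (φ : ACPath n T α → ℝ) : Prop where
  lsc : LowerSemicontinuous φ
  boundary : ∀ w : ACFun n hT α, σ w ≤ φ w.terminal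
  stable : ∀ p : ACPath n T α, (p.1.time : ℝ) < T → ∀ t : Icc (0 : ℝ) T, p.1.time < t →
    ∀ s : Vec n, ∀ ε > 0, ∃ xz ∈ characteristics hT cH H p 0 s,
      φ (xz.1.restr t) - xz.2 t ≤ φ p + ε

/-- `φ` is a lower solution of the Cauchy problem. -/
structure IsLowerSolution (hT : 0 < T) (cH : ℝ) (H : Icc (0 : ℝ) T → Vec n → Vec n → ℝ)
    (σ : ACFun n hT α → ℝ) (φ : ACPath n T α → ℝ) : Prop where
  usc : UpperSemicontinuous φ
  boundary : ∀ w : ACFun n hT α, φ w.terminal ≤ σ w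
  stable : ∀ p : ACPath n T α, (p.1.time : ℝ) < T → ∀ t : Icc (0 : ℝ) T, p.1.time < t →
    ∀ s : Vec n, ∀ ε > 0, ∃ xz ∈ characteristics hT cH H p 0 s,
      φ p - ε ≤ φ (xz.1.restr t) - xz.2 t

/-- A minimax solution is both an upper and a lower solution. -/
def IsMinimaxSolution (hT : 0 < T) (cH : ℝ) (H : Icc (0 : ℝ) T → Vec n → Vec n → ℝ)
    (σ : ACFun n hT α → ℝ) (φ : ACPath n T α → ℝ) : Prop :=
  IsUpperSolution hT cH H σ φ ∧ IsLowerSolution hT cH H σ φ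

end

end FracHJ

end

open MeasureTheory Set Filter Topology

noncomputable section

namespace FracHJ

variable {n : ℕ}

/-! ### The Abel kernel and the Riemann–Liouville integral -/

/-! Take `s` equal to the `ci`-gradient `v` in the stability property. The second component of a
characteristic is then determined by the first: it equals `⟨v, ∫ ᶜD^α x⟩ - ∫ H(τ, x(τ), v) dτ`. If
an extension `x` satisfies `φ(t, x_t) - φ(p) ≤ z(t)`, the gradient terms of the `ci`-expansion and
of `z` cancel, and division by `t - t₀` should give `a + H ≤ 0`.

The obstacle is that stability supplies an extension depending on `t` and `ε`, whereas the remainder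
`o(t - t₀)` is not uniform in the extension. One extension `y` must serve a whole sequence `t_j ↓
t₀` with no error. Characteristics are concatenated to handle finitely many times
(`exists_extension_forall_mem_finset`); letting the error vanish, compactness and lower
semicontinuity yield `y` (`exists_extension_forall_seq`).

The limit works because the inequality involves `ᶜD^α x` only through its integral, a difference of
values of `I^{1-α}(x - x(0))`. This is continuous in `x` for the maximum norm, so convergence of the
derivatives themselves is never needed, nor must `y` be a characteristic. Compactness rests on a
fractional Gronwall bound, a Hölder estimate and the closedness criterion
`isAC_of_lipschitzOn_caputoPrimitive`, all based on `I^{1-α} I^α = I^1`.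

The opposite inequality is the same result for `-φ`, `-H`, `-v`. -/

theorem rlIntegral_eq {β : ℝ} (ψ : ℝ → Vec n) {τ : ℝ} (hτ : 0 ≤ τ) :
    rlIntegral β ψ τ = (1 / Real.Gamma β) • ∫ ξ in (0 : ℝ)..τ, (τ - ξ) ^ (β - 1) • ψ ξ := by
  unfold rlIntegral
  congr 1
  refine intervalIntegral.integral_congr fun ξ hξ => ?_
  rw [uIcc_of_le hτ] at hξ
  have h : (τ - ξ) ^ (β - 1) = 1 / (τ - ξ) ^ (1 - β) := by
    rw [one_div, ← Real.rpow_neg (sub_nonneg.2 hξ.2), neg_sub]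
  simp only [h]

theorem intervalIntegrable_kernel {β : ℝ} (hβ : 0 < β) (τ a b : ℝ) :
    IntervalIntegrable (fun ξ : ℝ => (τ - ξ) ^ (β - 1)) volume a b := by
  have h : IntervalIntegrable (fun u : ℝ => u ^ (β - 1)) volume (τ - a) (τ - b) :=
    intervalIntegral.intervalIntegrable_rpow' (by linarith)
  simpa using h.comp_sub_left τ

theorem integral_kernel {β : ℝ} (hβ : 0 < β) (τ a b : ℝ) :
    ∫ ξ in a..b, (τ - ξ) ^ (β - 1) = ((τ - a) ^ β - (τ - b) ^ β) / β := by
  rw [intervalIntegral.integral_comp_sub_left (fun u : ℝ => u ^ (β - 1)) τ,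
    integral_rpow (Or.inl (by linarith))]
  simp

theorem intervalIntegrable_of_measurable_bounded {ψ : ℝ → Vec n} (hψ : Measurable ψ) {M : ℝ}
    (hM : ∀ ξ, ‖ψ ξ‖ ≤ M) (a b : ℝ) : IntervalIntegrable ψ volume a b :=
  (intervalIntegrable_const (c := M)).mono_fun hψ.aestronglyMeasurable
    (Eventually.of_forall fun ξ => (hM ξ).trans (Real.le_norm_self M))

theorem intervalIntegrable_kernel_smul {β : ℝ} (hβ : 0 < β) {ψ : ℝ → Vec n} (hψ : Measurable ψ)
    {M : ℝ} (hM : ∀ ξ, ‖ψ ξ‖ ≤ M) (τ a b : ℝ) :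
    IntervalIntegrable (fun ξ : ℝ => (τ - ξ) ^ (β - 1) • ψ ξ) volume a b := by
  refine ((intervalIntegrable_kernel hβ τ a b).mul_const M).mono_fun
    (by fun_prop) (Eventually.of_forall fun ξ => ?_)
  simp only [norm_smul, norm_mul]
  gcongr
  exact (hM ξ).trans (Real.le_norm_self M)

theorem rlIntegral_congr_ae {β : ℝ} {ψ χ : ℝ → Vec n} {τ : ℝ} (hτ : 0 ≤ τ)
    (h : ∀ᵐ ξ : ℝ, ξ ∈ Ioc 0 τ → ψ ξ = χ ξ) : rlIntegral β ψ τ = rlIntegral β χ τ := by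
  unfold rlIntegral
  congr 1
  refine intervalIntegral.integral_congr_ae ?_
  rw [uIoc_of_le hτ]
  filter_upwards [h] with ξ hξ hm
  rw [hξ hm]

theorem norm_rlIntegral_le {β : ℝ} (hβ : 0 < β) {ψ : ℝ → Vec n} {τ M : ℝ} (hτ : 0 ≤ τ)
    (hM : ∀ ξ ∈ Ioc 0 τ, ‖ψ ξ‖ ≤ M) :
    ‖rlIntegral β ψ τ‖ ≤ M * (τ ^ β / (β * Real.Gamma β)) := by
  have hΓ := Real.Gamma_pos_of_pos hβ
  rw [rlIntegral_eq ψ hτ, norm_smul, Real.norm_of_nonneg (by positivity)]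
  have h1 : ‖∫ ξ in (0 : ℝ)..τ, (τ - ξ) ^ (β - 1) • ψ ξ‖ ≤
      ∫ ξ in (0 : ℝ)..τ, (τ - ξ) ^ (β - 1) * M := by
    refine intervalIntegral.norm_integral_le_of_norm_le hτ (Eventually.of_forall fun ξ hξ => ?_)
      ((intervalIntegrable_kernel hβ τ 0 τ).mul_const M)
    have h0 : 0 ≤ (τ - ξ) ^ (β - 1) := Real.rpow_nonneg (sub_nonneg.2 hξ.2) _
    rw [norm_smul, Real.norm_of_nonneg h0]
    exact mul_le_mul_of_nonneg_left (hM ξ hξ) h0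
  rw [intervalIntegral.integral_mul_const, integral_kernel hβ, sub_self, Real.zero_rpow hβ.ne',
    sub_zero, sub_zero] at h1
  calc _ ≤ 1 / Real.Gamma β * (τ ^ β / β * M) := by gcongr
    _ = _ := by field_simp

/-! ### The semigroup identity `I^{1-α} I^α = I^1` -/

/-- After translation by `ξ` this is a Beta integral on `[0, τ - ξ]`; the exponents add up to `-1`,
so the length of the interval drops out and `Γ(1) = 1` leaves the product of Gammas. -/
theorem integral_kernel_mul_kernel {α : ℝ} (hα : α ∈ Ioo (0 : ℝ) 1) {ξ τ : ℝ} (h : ξ < τ) :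
    ∫ η in ξ..τ, (τ - η) ^ (1 - α - 1) * (η - ξ) ^ (α - 1) =
      Real.Gamma (1 - α) * Real.Gamma α := by
  have hc : 0 < τ - ξ := sub_pos.2 h
  have h1 : ∫ η in ξ..τ, (τ - η) ^ (1 - α - 1) * (η - ξ) ^ (α - 1) =
      ∫ y in (0 : ℝ)..(τ - ξ), y ^ (α - 1) * ((τ - ξ) - y) ^ (1 - α - 1) := by
    rw [← sub_self ξ, ← intervalIntegral.integral_comp_sub_right
      (fun y : ℝ => y ^ (α - 1) * ((τ - ξ) - y) ^ (1 - α - 1)) ξ]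
    refine intervalIntegral.integral_congr fun η _ => ?_
    simp only [sub_sub_sub_cancel_right]
    ring
  rw [h1]
  have h2 := Complex.betaIntegral_scaled (α : ℂ) ((1 - α : ℝ) : ℂ) hc
  have h3 := Complex.Gamma_mul_Gamma_eq_betaIntegral (s := (α : ℂ)) (t := ((1 - α : ℝ) : ℂ))
    (by simpa using hα.1) (by simpa using hα.2)
  have hsum : (α : ℂ) + ((1 - α : ℝ) : ℂ) = 1 := by push_cast; ring
  rw [hsum, Complex.Gamma_one, one_mul] at h3
  rw [hsum, sub_self, Complex.cpow_zero, one_mul, ← h3] at h2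
  have h4 : ((∫ y in (0 : ℝ)..(τ - ξ), y ^ (α - 1) * ((τ - ξ) - y) ^ (1 - α - 1) : ℝ) : ℂ) =
      ((Real.Gamma (1 - α) * Real.Gamma α : ℝ) : ℂ) := by
    rw [← intervalIntegral.integral_ofReal, Complex.ofReal_mul, ← Complex.Gamma_ofReal,
      ← Complex.Gamma_ofReal, mul_comm (Complex.Gamma _), ← h2]
    refine intervalIntegral.integral_congr fun y hy => ?_
    rw [uIcc_of_le hc.le] at hy
    have hy2 : 0 ≤ τ - ξ - y := sub_nonneg.2 hy.2
    simp only [Complex.ofReal_mul, Complex.ofReal_cpow hy.1, Complex.ofReal_cpow hy2]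
    push_cast
    rfl
  exact_mod_cast h4

/-- The kernel `(τ - η)^{-α} (η - ξ)^{α-1}` on the triangle `ξ ≤ η`. -/
def triangleKernel (α τ : ℝ) (q : ℝ × ℝ) : ℝ :=
  {q : ℝ × ℝ | q.2 ≤ q.1}.indicator
    (fun q => (τ - q.1) ^ (1 - α - 1) * (q.1 - q.2) ^ (α - 1)) q

theorem measurable_triangleKernel (α τ : ℝ) : Measurable (triangleKernel α τ) :=
  Measurable.indicator (by fun_prop) (measurableSet_le measurable_snd measurable_fst)

theorem setIntegral_Ioc_indicator_Iic {E : Type*} [NormedAddCommGroup E] [NormedSpace ℝ E]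
    (f : ℝ → E) {η τ : ℝ} (hη : η ∈ Ioc 0 τ) :
    ∫ ξ in Ioc 0 τ, (Iic η).indicator f ξ = ∫ ξ in (0 : ℝ)..η, f ξ := by
  rw [setIntegral_indicator measurableSet_Iic, intervalIntegral.integral_of_le hη.1.le,
    Ioc_inter_Iic, min_eq_right hη.2]

theorem setIntegral_Ioc_indicator_Ici {E : Type*} [NormedAddCommGroup E] [NormedSpace ℝ E]
    (f : ℝ → E) {ξ τ : ℝ} (hξ : ξ ∈ Ioc 0 τ) :
    ∫ η in Ioc 0 τ, (Ici ξ).indicator f η = ∫ η in ξ..τ, f η := by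
  rw [setIntegral_indicator measurableSet_Ici, intervalIntegral.integral_of_le hξ.2,
    ← integral_Icc_eq_integral_Ioc]
  congr 2
  ext y
  simp only [mem_inter_iff, mem_Ioc, mem_Ici, mem_Icc]
  exact ⟨fun h => ⟨h.2, h.1.2⟩, fun h => ⟨⟨hξ.1.trans_le h.1, h.2⟩, h.1⟩⟩

theorem triangleKernel_left (α τ η : ℝ) : (fun ξ => triangleKernel α τ (η, ξ)) =
    (Iic η).indicator fun ξ => (τ - η) ^ (1 - α - 1) * (η - ξ) ^ (α - 1) := by
  ext ξ
  simp [triangleKernel, indicator]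

theorem triangleKernel_right (α τ ξ : ℝ) : (fun η => triangleKernel α τ (η, ξ)) =
    (Ici ξ).indicator fun η => (τ - η) ^ (1 - α - 1) * (η - ξ) ^ (α - 1) := by
  ext η
  simp [triangleKernel, indicator]

/-- Fubini needs absolute integrability: the kernel is nonnegative on the square and its inner
integral in `ξ` is `(τ - η)^{-α} η^α / α`, integrable since `α < 1`. -/
theorem integrable_triangleKernel {α : ℝ} (hα : α ∈ Ioo (0 : ℝ) 1) (τ : ℝ) :
    Integrable (triangleKernel α τ)
      ((volume.restrict (Ioc 0 τ)).prod (volume.restrict (Ioc 0 τ))) := by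
  rw [integrable_prod_iff (measurable_triangleKernel α τ).aestronglyMeasurable]
  constructor
  · refine (ae_restrict_iff' measurableSet_Ioc).2 (Eventually.of_forall fun η hη => ?_)
    rw [triangleKernel_left]
    refine Integrable.indicator ?_ measurableSet_Iic
    exact ((intervalIntegrable_kernel hα.1 η 0 τ).const_mul _).1
  · have hint : IntervalIntegrable (fun η : ℝ => (τ - η) ^ (1 - α - 1) * (η ^ α / α))
        volume 0 τ :=
      (intervalIntegrable_kernel (by linarith [hα.2]) τ 0 τ).mul_continuousOn
        ((Real.continuous_rpow_const hα.1.le).div_const α).continuousOn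
    refine hint.1.congr ((ae_restrict_iff' measurableSet_Ioc).2
      (Eventually.of_forall fun η hη => ?_))
    have hpos : ∀ ξ, ‖triangleKernel α τ (η, ξ)‖ = triangleKernel α τ (η, ξ) := fun ξ => by
      refine Real.norm_of_nonneg (indicator_apply_nonneg ?_)
      intro hq
      exact mul_nonneg (Real.rpow_nonneg (sub_nonneg.2 hη.2) _)
        (Real.rpow_nonneg (sub_nonneg.2 hq) _)
    simp only [hpos]
    rw [triangleKernel_left, setIntegral_Ioc_indicator_Iic _ hη,
      intervalIntegral.integral_const_mul, integral_kernel hα.1]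
    simp [Real.zero_rpow hα.1.ne']

/-- Exchanging the order of integration over the triangle `ξ ≤ η ≤ τ` turns the kernel into the
constant `Γ(1-α) Γ(α)`, which the two normalisations cancel. -/
theorem rlIntegral_rlIntegral {α : ℝ} (hα : α ∈ Ioo (0 : ℝ) 1) {ψ : ℝ → Vec n}
    (hψ : Measurable ψ) {M : ℝ} (hM : ∀ ξ, ‖ψ ξ‖ ≤ M) {τ : ℝ} (hτ : 0 ≤ τ) :
    rlIntegral (1 - α) (rlIntegral α ψ) τ = ∫ ξ in (0 : ℝ)..τ, ψ ξ := by
  have hα' : 0 < 1 - α := sub_pos.2 hα.2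
  have hΓ := (Real.Gamma_pos_of_pos hα.1).ne'
  have hΓ' := (Real.Gamma_pos_of_pos hα').ne'
  have hint : Integrable (fun q : ℝ × ℝ => triangleKernel α τ q • ψ q.2)
      ((volume.restrict (Ioc 0 τ)).prod (volume.restrict (Ioc 0 τ))) := by
    refine ((integrable_triangleKernel hα τ).mul_const M).mono
      ((measurable_triangleKernel α τ).smul (hψ.comp measurable_snd)).aestronglyMeasurable
      (Eventually.of_forall fun q => ?_)
    rw [norm_smul, norm_mul]
    gcongr
    exact (hM _).trans (Real.le_norm_self M)
  have hleft : ∫ η in Ioc 0 τ, ∫ ξ in Ioc 0 τ, triangleKernel α τ (η, ξ) • ψ ξ =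
      Real.Gamma α • ∫ η in (0 : ℝ)..τ, (τ - η) ^ (1 - α - 1) • rlIntegral α ψ η := by
    rw [← intervalIntegral.integral_smul, intervalIntegral.integral_of_le hτ]
    refine setIntegral_congr_fun measurableSet_Ioc fun η hη => ?_
    have h1 : (fun ξ => triangleKernel α τ (η, ξ) • ψ ξ) =
        (Iic η).indicator fun ξ => (τ - η) ^ (1 - α - 1) • ((η - ξ) ^ (α - 1) • ψ ξ) := by
      ext1 ξ
      by_cases h : ξ ≤ η <;> simp [triangleKernel, h, smul_smul]
    rw [h1, setIntegral_Ioc_indicator_Iic _ hη, intervalIntegral.integral_smul,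
      rlIntegral_eq ψ hη.1.le, smul_comm, smul_smul (Real.Gamma α), mul_one_div_cancel hΓ, one_smul]
  have hright : ∫ ξ in Ioc 0 τ, ∫ η in Ioc 0 τ, triangleKernel α τ (η, ξ) • ψ ξ =
      (Real.Gamma (1 - α) * Real.Gamma α) • ∫ ξ in (0 : ℝ)..τ, ψ ξ := by
    rw [← intervalIntegral.integral_smul, intervalIntegral.integral_of_le hτ]
    refine setIntegral_congr_ae measurableSet_Ioc ?_
    filter_upwards [Measure.ae_ne volume τ] with ξ hne hξ
    rw [integral_smul_const, triangleKernel_right, setIntegral_Ioc_indicator_Ici _ hξ,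
      integral_kernel_mul_kernel hα (lt_of_le_of_ne hξ.2 hne)]
  have hswap := integral_integral_swap (f := fun η ξ => triangleKernel α τ (η, ξ) • ψ ξ) hint
  rw [hleft, hright] at hswap
  rw [rlIntegral_eq _ hτ]
  have : ∫ η in (0 : ℝ)..τ, (τ - η) ^ (1 - α - 1) • rlIntegral α ψ η =
      Real.Gamma (1 - α) • ∫ ξ in (0 : ℝ)..τ, ψ ξ := by
    have h := congrArg (fun y => (Real.Gamma α)⁻¹ • y) hswap
    simpa [smul_smul, hΓ, mul_comm, mul_assoc] using h
  rw [this, smul_smul, one_div_mul_cancel hΓ', one_smul]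

/-! ### Regularity of fractional integrals of bounded functions -/

/-- On `[0, s]` the difference of the kernels has a sign and integrates explicitly. Together with
the piece over `[s, t]` this gives `(s^α - t^α + 2(t - s)^α) M / α`, and `s^α ≤ t^α`. -/
theorem norm_integral_kernel_sub_le {α : ℝ} (hα : α ∈ Ioo (0 : ℝ) 1) {ψ : ℝ → Vec n}
    (hψ : Measurable ψ) {M : ℝ} (hM : ∀ ξ, ‖ψ ξ‖ ≤ M) {s t : ℝ} (hs : 0 ≤ s) (hst : s ≤ t) :
    ‖(∫ ξ in (0 : ℝ)..t, (t - ξ) ^ (α - 1) • ψ ξ) - ∫ ξ in (0 : ℝ)..s, (s - ξ) ^ (α - 1) • ψ ξ‖ ≤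
      2 * M / α * (t - s) ^ α := by
  have hα0 := hα.1
  have hM0 : 0 ≤ M := (norm_nonneg _).trans (hM 0)
  have hk := fun τ a b => intervalIntegrable_kernel_smul hα.1 hψ hM τ a b
  have hk' := fun τ a b => intervalIntegrable_kernel hα.1 τ a b
  rw [← intervalIntegral.integral_add_adjacent_intervals (hk t 0 s) (hk t s t), add_sub_right_comm,
    ← intervalIntegral.integral_sub (hk t 0 s) (hk s 0 s)]
  have h1 : ‖∫ ξ in (0 : ℝ)..s, ((t - ξ) ^ (α - 1) • ψ ξ - (s - ξ) ^ (α - 1) • ψ ξ)‖ ≤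
      ∫ ξ in (0 : ℝ)..s, ((s - ξ) ^ (α - 1) - (t - ξ) ^ (α - 1)) * M := by
    refine intervalIntegral.norm_integral_le_of_norm_le hs ?_
      (((hk' s 0 s).sub (hk' t 0 s)).mul_const M)
    -- At `ξ = s` the convention `0 ^ (α - 1) = 0` would break the monotonicity of the kernel.
    filter_upwards [Measure.ae_ne volume s] with ξ hne hξ
    have hlt : ξ < s := lt_of_le_of_ne hξ.2 hne
    have hle : (t - ξ) ^ (α - 1) ≤ (s - ξ) ^ (α - 1) :=
      Real.rpow_le_rpow_of_nonpos (sub_pos.2 hlt) (by linarith) (by linarith [hα.2])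
    rw [← sub_smul, norm_smul, Real.norm_eq_abs, abs_sub_comm, abs_of_nonneg (sub_nonneg.2 hle)]
    exact mul_le_mul_of_nonneg_left (hM ξ) (sub_nonneg.2 hle)
  have h2 : ‖∫ ξ in s..t, (t - ξ) ^ (α - 1) • ψ ξ‖ ≤ ∫ ξ in s..t, (t - ξ) ^ (α - 1) * M := by
    refine intervalIntegral.norm_integral_le_of_norm_le hst
      (Eventually.of_forall fun ξ hξ => ?_) ((hk' t s t).mul_const M)
    have h0 : 0 ≤ (t - ξ) ^ (α - 1) := Real.rpow_nonneg (sub_nonneg.2 hξ.2) _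
    rw [norm_smul, Real.norm_of_nonneg h0]
    exact mul_le_mul_of_nonneg_left (hM ξ) h0
  rw [intervalIntegral.integral_mul_const, intervalIntegral.integral_sub (hk' s 0 s) (hk' t 0 s),
    integral_kernel hα.1, integral_kernel hα.1] at h1
  rw [intervalIntegral.integral_mul_const, integral_kernel hα.1] at h2
  simp only [sub_self, Real.zero_rpow hα.1.ne', sub_zero] at h1 h2
  refine (norm_add_le _ _).trans ((add_le_add h1 h2).trans ?_)
  have h3 : s ^ α ≤ t ^ α := Real.rpow_le_rpow hs hst hα.1.le
  have h4 : (s ^ α - (t ^ α - (t - s) ^ α) + (t - s) ^ α) * (M / α) ≤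
      (2 * (t - s) ^ α) * (M / α) :=
    mul_le_mul_of_nonneg_right (by linarith) (by positivity)
  calc _ = (s ^ α - (t ^ α - (t - s) ^ α) + (t - s) ^ α) * (M / α) := by ring
    _ ≤ _ := h4
    _ = _ := by ring

/-- Fractional integrals of bounded functions are Hölder continuous. -/
theorem norm_rlIntegral_sub_le {α : ℝ} (hα : α ∈ Ioo (0 : ℝ) 1) {ψ : ℝ → Vec n}
    (hψ : Measurable ψ) {M : ℝ} (hM : ∀ ξ, ‖ψ ξ‖ ≤ M) {s t : ℝ} (hs : 0 ≤ s) (ht : 0 ≤ t) :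
    ‖rlIntegral α ψ t - rlIntegral α ψ s‖ ≤ 2 * M / (α * Real.Gamma α) * |t - s| ^ α := by
  wlog hst : s ≤ t generalizing s t
  · rw [norm_sub_rev, abs_sub_comm]
    exact this ht hs (le_of_not_ge hst)
  have hα0 := hα.1
  have hΓ := Real.Gamma_pos_of_pos hα.1
  rw [rlIntegral_eq ψ hs, rlIntegral_eq ψ ht, ← smul_sub, norm_smul,
    Real.norm_of_nonneg (by positivity), abs_of_nonneg (sub_nonneg.2 hst)]
  calc _ ≤ 1 / Real.Gamma α * (2 * M / α * (t - s) ^ α) := by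
        gcongr
        exact norm_integral_kernel_sub_le hα hψ hM hs hst
    _ = _ := by field_simp

theorem continuousOn_rlIntegral {α : ℝ} (hα : α ∈ Ioo (0 : ℝ) 1) {ψ : ℝ → Vec n}
    (hψ : Measurable ψ) {M : ℝ} (hM : ∀ ξ, ‖ψ ξ‖ ≤ M) :
    ContinuousOn (rlIntegral α ψ) (Ici 0) := by
  intro s hs
  rw [ContinuousWithinAt, tendsto_iff_norm_sub_tendsto_zero]
  have hlim : Tendsto (fun t : ℝ => 2 * M / (α * Real.Gamma α) * |t - s| ^ α) (𝓝[Ici 0] s)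
      (𝓝 0) := by
    have hc : Continuous fun t : ℝ => 2 * M / (α * Real.Gamma α) * |t - s| ^ α :=
      continuous_const.mul ((continuous_abs.comp (continuous_id.sub continuous_const)).rpow_const
        fun _ => Or.inr hα.1.le)
    have h := hc.tendsto s
    rw [sub_self, abs_zero, Real.zero_rpow hα.1.ne', mul_zero] at h
    exact h.mono_left nhdsWithin_le_nhds
  refine squeeze_zero' (Eventually.of_forall fun _ => norm_nonneg _) ?_ hlim
  filter_upwards [self_mem_nhdsWithin] with t ht
  exact norm_rlIntegral_sub_le hα hψ hM hs ht

/-- The difference between `g` and the integral of its derivative is absolutely continuous with zero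
derivative a.e., hence constant. -/
theorem integral_deriv_eq_sub_of_lipschitzWith {F : Type*} [NormedAddCommGroup F] [NormedSpace ℝ F]
    [FiniteDimensional ℝ F] {K : NNReal} {g : ℝ → F} (hg : LipschitzWith K g) (a b : ℝ) :
    ∫ τ in a..b, deriv g τ = g b - g a := by
  have hfin : CompleteSpace F := FiniteDimensional.complete ℝ F
  have hK : ∀ τ, ‖deriv g τ‖ ≤ K := fun τ => norm_deriv_le_of_lipschitz hg
  have hmeas : ∀ μ : Measure ℝ, AEStronglyMeasurable (deriv g) μ :=
    fun μ => aestronglyMeasurable_deriv g μ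
  have hloc : LocallyIntegrable (deriv g) volume :=
    (locallyIntegrable_const (K : ℝ)).mono (hmeas _)
      (Eventually.of_forall fun τ => (hK τ).trans (Real.le_norm_self _))
  have hint : ∀ a b, IntervalIntegrable (deriv g) volume a b := fun a b =>
    (intervalIntegrable_const (c := (K : ℝ))).mono_fun (hmeas _)
      (Eventually.of_forall fun τ => (hK τ).trans (Real.le_norm_self _))
  have hlip : LipschitzWith K (fun t => ∫ τ in a..t, deriv g τ) :=
    LipschitzWith.of_dist_le_mul fun s t => by
      rw [dist_eq_norm, intervalIntegral.integral_interval_sub_left (hint _ _) (hint _ _),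
        Real.dist_eq]
      exact intervalIntegral.norm_integral_le_of_norm_le_const fun τ _ => hK τ
  have hac : AbsolutelyContinuousOnInterval (fun t => g t - ∫ τ in a..t, deriv g τ) a b :=
    AbsolutelyContinuousOnInterval.sub hg.lipschitzOnWith.absolutelyContinuousOnInterval
      hlip.lipschitzOnWith.absolutelyContinuousOnInterval
  have hderiv : ∀ᵐ τ : ℝ, τ ∈ uIcc a b →
      HasDerivAt (fun t => g t - ∫ τ in a..t, deriv g τ) 0 τ := by
    filter_upwards [hg.ae_differentiableAt_real,
      LocallyIntegrable.ae_hasDerivAt_integral hloc] with τ h1 h2 _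
    have h := h1.hasDerivAt.sub (h2 a)
    rwa [sub_self] at h
  obtain ⟨C, hC⟩ := hac.const_of_ae_hasDerivAt_zero hderiv
  have ha := hC a left_mem_uIcc
  have hb := hC b right_mem_uIcc
  simp only [intervalIntegral.integral_same, sub_zero] at ha
  rw [← ha] at hb
  rw [← hb]
  abel

theorem eq_zero_of_integral_eq_zero {T : ℝ} (hT : 0 < T) {u : ℝ → Vec n} (hu : Continuous u)
    (h : ∀ τ ∈ Icc 0 T, ∫ ξ in (0 : ℝ)..τ, u ξ = 0) : ∀ τ ∈ Icc 0 T, u τ = 0 := by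
  have hopen : ∀ τ ∈ Ioo 0 T, u τ = 0 := fun τ hτ => by
    have h1 : HasDerivAt (fun t => ∫ ξ in (0 : ℝ)..t, u ξ) (u τ) τ :=
      intervalIntegral.integral_hasDerivAt_right (hu.intervalIntegrable _ _)
        hu.stronglyMeasurable.stronglyMeasurableAtFilter hu.continuousAt
    refine h1.unique ((hasDerivAt_const τ (0 : Vec n)).congr_of_eventuallyEq ?_)
    filter_upwards [Ioo_mem_nhds hτ.1 hτ.2] with t ht
    exact h t (Ioo_subset_Icc_self ht)
  intro τ hτ
  rw [← closure_Ioo hT.ne] at hτ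
  exact (isClosed_singleton.preimage hu).closure_subset_iff.2 hopen hτ

/-! ### The Caputo derivative -/

section

variable {T : ℝ} {α : ℝ}

/-- The increment `x(·) - x(0)`, extended constantly beyond `[0, T]`. -/
def increment (hT : 0 < T) (x : C(Icc (0 : ℝ) T, Vec n)) (ξ : ℝ) : Vec n :=
  IccExtend hT.le x ξ - x ⟨0, left_mem_Icc.2 hT.le⟩

/-- The function `I^{1-α}(x(·) - x(0))` whose derivative is the Caputo derivative of `x`. -/
def caputoPrimitive (hT : 0 < T) (α : ℝ) (x : C(Icc (0 : ℝ) T, Vec n)) : ℝ → Vec n :=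
  rlIntegral (1 - α) (increment hT x)

theorem caputo_eq_deriv (hT : 0 < T) (x : C(Icc (0 : ℝ) T, Vec n)) :
    caputo hT α x = deriv (caputoPrimitive hT α x) := rfl

theorem continuous_increment (hT : 0 < T) (x : C(Icc (0 : ℝ) T, Vec n)) :
    Continuous (increment hT x) :=
  (x.continuous.Icc_extend' (h := hT.le)).sub continuous_const

theorem norm_increment_le (hT : 0 < T) (x : C(Icc (0 : ℝ) T, Vec n)) (ξ : ℝ) :
    ‖increment hT x ξ‖ ≤ 2 * ‖x‖ := by
  refine (norm_sub_le _ _).trans ?_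
  have h1 : ‖IccExtend hT.le x ξ‖ ≤ ‖x‖ := x.norm_coe_le_norm _
  have h2 := x.norm_coe_le_norm ⟨0, left_mem_Icc.2 hT.le⟩
  linarith

theorem measurable_caputo (hT : 0 < T) (x : C(Icc (0 : ℝ) T, Vec n)) :
    Measurable (caputo hT α x) := measurable_deriv _

theorem caputoPrimitive_congr (hT : 0 < T) {x y : C(Icc (0 : ℝ) T, Vec n)} {b : ℝ}
    (hb : b ∈ Icc 0 T) (h : ∀ τ : Icc (0 : ℝ) T, (τ : ℝ) ≤ b → x τ = y τ) {τ : ℝ}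
    (hτ : τ ∈ Icc 0 b) : caputoPrimitive hT α x τ = caputoPrimitive hT α y τ := by
  refine rlIntegral_congr_ae hτ.1 (Eventually.of_forall fun ξ hξ => ?_)
  have hξT : ξ ∈ Icc 0 T := ⟨hξ.1.le, hξ.2.trans (hτ.2.trans hb.2)⟩
  simp only [increment, IccExtend_of_mem hT.le _ hξT]
  rw [h _ (hξ.2.trans hτ.2), h ⟨0, _⟩ hb.1]

/-- Causality: the primitive at `τ` depends only on the past of `τ`. The interval is open because
the two-sided derivative at `b` would see values beyond `b`. -/
theorem caputo_congr (hT : 0 < T) {x y : C(Icc (0 : ℝ) T, Vec n)} {b : ℝ}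
    (hb : b ∈ Icc 0 T) (h : ∀ τ : Icc (0 : ℝ) T, (τ : ℝ) ≤ b → x τ = y τ) {τ : ℝ}
    (hτ : τ ∈ Ioo 0 b) : caputo hT α x τ = caputo hT α y τ := by
  rw [caputo_eq_deriv, caputo_eq_deriv]
  refine EventuallyEq.deriv_eq ?_
  filter_upwards [Ioo_mem_nhds hτ.1 hτ.2] with t ht
  exact caputoPrimitive_congr hT hb h (Ioo_subset_Icc_self ht)

/-- A measurable representative is truncated to zero where it exceeds `M`, so that later estimates
can use bounds valid everywhere. -/
theorem exists_measurable_bounded_eq_ae {ψ : ℝ → Vec n} {s : Set ℝ} (hs : MeasurableSet s) {M : ℝ}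
    (hM0 : 0 ≤ M) (hψ : AEStronglyMeasurable ψ (volume.restrict s))
    (hM : ∀ᵐ ξ : ℝ, ξ ∈ s → ‖ψ ξ‖ ≤ M) :
    ∃ χ : ℝ → Vec n, Measurable χ ∧ (∀ ξ, ‖χ ξ‖ ≤ M) ∧ ∀ᵐ ξ : ℝ, ξ ∈ s → ψ ξ = χ ξ := by
  have hg := hψ.stronglyMeasurable_mk.measurable
  refine ⟨{ξ | ‖hψ.mk ψ ξ‖ ≤ M}.indicator (hψ.mk ψ),
    hg.indicator (measurableSet_le hg.norm measurable_const), fun ξ => ?_, ?_⟩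
  · by_cases h : ‖hψ.mk ψ ξ‖ ≤ M
    · rwa [indicator_of_mem (by exact h)]
    · rwa [indicator_of_notMem (by exact h), norm_zero]
  · filter_upwards [(ae_restrict_iff' hs).1 hψ.ae_eq_mk, hM] with ξ h1 h2 hξ
    have h3 := h2 hξ
    rw [h1 hξ] at h3
    rw [indicator_of_mem (by exact h3), h1 hξ]

theorem IsAC.exists_measurable_bounded {t : ℝ} {ht : 0 ≤ t} {w : C(Icc (0 : ℝ) t, Vec n)}
    (hw : IsAC α ht w) : ∃ ψ : ℝ → Vec n, Measurable ψ ∧ (∃ M, ∀ ξ, ‖ψ ξ‖ ≤ M) ∧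
      ∀ τ : Icc (0 : ℝ) t, w τ = w ⟨0, left_mem_Icc.2 ht⟩ + rlIntegral α ψ τ := by
  obtain ⟨ψ, hψ, h⟩ := hw
  obtain ⟨χ, h1, h2, h3⟩ := exists_measurable_bounded_eq_ae (M := lpNorm ψ ⊤ _) measurableSet_Icc
    lpNorm_nonneg hψ.1 ((ae_restrict_iff' measurableSet_Icc).1 (ae_le_lpNorm_exponent_top hψ))
  refine ⟨χ, h1, ⟨_, h2⟩, fun τ => ?_⟩
  rw [h τ, rlIntegral_congr_ae τ.2.1]
  filter_upwards [h3] with ξ hξ hm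
  exact hξ ⟨hm.1.le, hm.2.trans τ.2.2⟩

/-- The semigroup identity identifies the primitive with the integral of `ψ`; Lebesgue
differentiation then recovers `ψ`. -/
theorem ae_caputo_eq (hα : α ∈ Ioo (0 : ℝ) 1) (hT : 0 < T) {x : C(Icc (0 : ℝ) T, Vec n)}
    {ψ : ℝ → Vec n} (hψ : Measurable ψ) {M : ℝ} (hM : ∀ ξ, ‖ψ ξ‖ ≤ M)
    (hx : ∀ τ : Icc (0 : ℝ) T, x τ = x ⟨0, left_mem_Icc.2 hT.le⟩ + rlIntegral α ψ τ) :
    (∀ τ ∈ Icc 0 T, caputoPrimitive hT α x τ = ∫ ξ in (0 : ℝ)..τ, ψ ξ) ∧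
      ∀ᵐ τ : ℝ, τ ∈ Icc 0 T → caputo hT α x τ = ψ τ := by
  have hprim : ∀ τ ∈ Icc 0 T, caputoPrimitive hT α x τ = ∫ ξ in (0 : ℝ)..τ, ψ ξ := by
    intro τ hτ
    rw [← rlIntegral_rlIntegral hα hψ hM hτ.1]
    refine rlIntegral_congr_ae hτ.1 (Eventually.of_forall fun ξ hξ => ?_)
    have hξT : ξ ∈ Icc 0 T := ⟨hξ.1.le, hξ.2.trans hτ.2⟩
    rw [increment, IccExtend_of_mem hT.le _ hξT, hx, add_sub_cancel_left]
  refine ⟨hprim, ?_⟩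
  have hloc : LocallyIntegrable ψ volume :=
    (locallyIntegrable_const M).mono hψ.aestronglyMeasurable
      (Eventually.of_forall fun τ => (hM τ).trans (Real.le_norm_self M))
  filter_upwards [LocallyIntegrable.ae_hasDerivAt_integral hloc, Measure.ae_ne volume 0, Measure.ae_ne volume T]
    with τ h1 h2 h3 hτ
  have hτ' : τ ∈ Ioo 0 T := ⟨lt_of_le_of_ne hτ.1 h2.symm, lt_of_le_of_ne hτ.2 h3⟩
  rw [caputo_eq_deriv]
  refine HasDerivAt.deriv ((h1 0).congr_of_eventuallyEq ?_)
  filter_upwards [Ioo_mem_nhds hτ'.1 hτ'.2] with t ht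
  exact hprim t (Ioo_subset_Icc_self ht)

theorem IsAC.ae_norm_caputo_le (hα : α ∈ Ioo (0 : ℝ) 1) {hT : 0 < T}
    {x : C(Icc (0 : ℝ) T, Vec n)} (hx : IsAC α hT.le x) :
    ∃ M, 0 ≤ M ∧ ∀ᵐ τ : ℝ, τ ∈ Icc 0 T → ‖caputo hT α x τ‖ ≤ M := by
  obtain ⟨ψ, hψ, ⟨M, hM⟩, h⟩ := hx.exists_measurable_bounded
  refine ⟨M, (norm_nonneg _).trans (hM 0), ?_⟩
  filter_upwards [(ae_caputo_eq hα hT hψ hM h).2] with τ h1 hτ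
  rw [h1 hτ]
  exact hM τ

/-- Recovery of `x` from its Caputo derivative. -/
theorem IsAC.eq_add_rlIntegral (hα : α ∈ Ioo (0 : ℝ) 1) {hT : 0 < T}
    {x : C(Icc (0 : ℝ) T, Vec n)} (hx : IsAC α hT.le x) (τ : Icc (0 : ℝ) T) :
    x τ = x ⟨0, left_mem_Icc.2 hT.le⟩ + rlIntegral α (caputo hT α x) τ := by
  obtain ⟨ψ, hψ, ⟨M, hM⟩, h⟩ := hx.exists_measurable_bounded
  rw [h τ, rlIntegral_congr_ae τ.2.1]
  filter_upwards [(ae_caputo_eq hα hT hψ hM h).2] with ξ h1 hξ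
  exact (h1 ⟨hξ.1.le, hξ.2.trans τ.2.2⟩).symm

theorem IsAC.integral_caputo (hα : α ∈ Ioo (0 : ℝ) 1) {hT : 0 < T}
    {x : C(Icc (0 : ℝ) T, Vec n)} (hx : IsAC α hT.le x) {a b : ℝ} (ha : a ∈ Icc 0 T)
    (hb : b ∈ Icc 0 T) : IntervalIntegrable (caputo hT α x) volume a b ∧
    ∫ τ in a..b, caputo hT α x τ = caputoPrimitive hT α x b - caputoPrimitive hT α x a := by
  obtain ⟨ψ, hψ, ⟨M, hM⟩, h⟩ := hx.exists_measurable_bounded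
  obtain ⟨h1, h2⟩ := ae_caputo_eq hα hT hψ hM h
  have hint := fun a b => intervalIntegrable_of_measurable_bounded hψ hM a b
  have hsub : uIoc a b ⊆ Icc 0 T := uIoc_subset_uIcc.trans (uIcc_subset_Icc ha hb)
  have hae : ∀ᵐ τ : ℝ, τ ∈ uIoc a b → caputo hT α x τ = ψ τ := by
    filter_upwards [h2] with τ h3 hτ using h3 (hsub hτ)
  constructor
  · refine (hint a b).congr_ae ?_
    rw [EventuallyEq, ae_restrict_iff' measurableSet_uIoc]
    filter_upwards [hae] with τ h3 hτ using (h3 hτ).symm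
  · rw [intervalIntegral.integral_congr_ae hae, h1 a ha, h1 b hb,
      intervalIntegral.integral_interval_sub_left (hint _ _) (hint _ _)]

/-- With `ψ` the derivative of the primitive, `I^{1-α}(x - x(0)) = I^1 ψ = I^{1-α} I^α ψ`. Applying
`I^α` gives `I^1(x - x(0)) = I^1 I^α ψ`, and the integrands are continuous, hence equal. Unlike an
a.e. bound on the derivative, the Lipschitz condition passes directly to uniform limits. -/
theorem isAC_of_lipschitzOn_caputoPrimitive (hα : α ∈ Ioo (0 : ℝ) 1) (hT : 0 < T)
    {x : C(Icc (0 : ℝ) T, Vec n)} {K : NNReal}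
    (hK : LipschitzOnWith K (caputoPrimitive hT α x) (Icc 0 T)) : IsAC α hT.le x := by
  have hα' : 1 - α ∈ Ioo (0 : ℝ) 1 := ⟨by linarith [hα.2], by linarith [hα.1]⟩
  set g : ℝ → Vec n := IccExtend hT.le ((Icc 0 T).domRestrict (caputoPrimitive hT α x)) with hg
  have hgeq : ∀ τ ∈ Icc 0 T, g τ = caputoPrimitive hT α x τ := fun τ hτ =>
    IccExtend_of_mem hT.le _ hτ
  have hglip : LipschitzWith K g := by
    have h := hK.to_restrict.comp (LipschitzWith.projIcc hT.le)
    rwa [mul_one] at h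
  set ψ := deriv g
  have hψ : Measurable ψ := measurable_deriv g
  have hM : ∀ ξ, ‖ψ ξ‖ ≤ K := fun ξ => norm_deriv_le_of_lipschitz hglip
  have hprim : ∀ τ ∈ Icc 0 T, caputoPrimitive hT α x τ = rlIntegral (1 - α) (rlIntegral α ψ) τ := by
    intro τ hτ
    have h0 : caputoPrimitive hT α x 0 = 0 := by simp [caputoPrimitive, rlIntegral]
    rw [rlIntegral_rlIntegral hα hψ hM hτ.1, integral_deriv_eq_sub_of_lipschitzWith hglip,
      hgeq τ hτ, hgeq 0 (left_mem_Icc.2 hT.le), h0, sub_zero]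
  set y : C(Icc (0 : ℝ) T, Vec n) := ⟨(Icc 0 T).domRestrict (rlIntegral α ψ),
    ((continuousOn_rlIntegral hα hψ hM).mono fun τ hτ => hτ.1).domRestrict⟩ with hy
  set χ : ℝ → Vec n := IccExtend hT.le y
  have hχ : Continuous χ := y.continuous.Icc_extend'
  have hχM : ∀ ξ, ‖χ ξ‖ ≤ ‖y‖ := fun ξ => y.norm_coe_le_norm _
  have hχeq : ∀ τ ∈ Icc 0 T, χ τ = rlIntegral α ψ τ := fun τ hτ => IccExtend_of_mem hT.le _ hτ
  have hinc := continuous_increment hT x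
  have hint : ∀ τ ∈ Icc 0 T, ∫ ξ in (0 : ℝ)..τ, (increment hT x ξ - χ ξ) = 0 := by
    intro τ hτ
    have hsub : ∀ ξ ∈ Ioc 0 τ, ξ ∈ Icc 0 T := fun ξ hξ => ⟨hξ.1.le, hξ.2.trans hτ.2⟩
    -- The semigroup identity is used here at order `1 - α`, the outer integral having order `1 - (1
    -- - α)`, that is, `α`.
    rw [intervalIntegral.integral_sub (hinc.intervalIntegrable _ _) (hχ.intervalIntegrable _ _),
      ← rlIntegral_rlIntegral hα' hinc.measurable (norm_increment_le hT x) hτ.1,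
      ← rlIntegral_rlIntegral hα' hχ.measurable hχM hτ.1, sub_eq_zero]
    refine rlIntegral_congr_ae hτ.1 (Eventually.of_forall fun ξ hξ => ?_)
    refine (hprim ξ (hsub ξ hξ)).trans
      (rlIntegral_congr_ae hξ.1.le (Eventually.of_forall fun η hη => ?_))
    exact (hχeq η ⟨hη.1.le, hη.2.trans (hsub ξ hξ).2⟩).symm
  have hzero := eq_zero_of_integral_eq_zero hT (hinc.sub hχ) hint
  refine ⟨ψ, memLp_top_of_bound hψ.aestronglyMeasurable K (Eventually.of_forall hM), fun τ => ?_⟩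
  have h := sub_eq_zero.1 (hzero τ τ.2)
  rw [hχeq τ τ.2, increment, IccExtend_of_mem hT.le _ τ.2, sub_eq_iff_eq_add'] at h
  exact h

end

/-! ### A priori bounds -/

section

variable {T : ℝ} {α : ℝ}

/-- The substitution `u = τ - ξ` extracts `exp (l τ)`; the remaining integral is enlarged to the
half-line, where it is a Gamma integral. -/
theorem integral_kernel_mul_exp_le {α l τ : ℝ} (hα : 0 < α) (hl : 0 < l) (hτ : 0 ≤ τ) :
    ∫ ξ in (0 : ℝ)..τ, (τ - ξ) ^ (α - 1) * Real.exp (l * ξ) ≤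
      Real.exp (l * τ) * ((1 / l) ^ α * Real.Gamma α) := by
  have h1 : ∫ ξ in (0 : ℝ)..τ, (τ - ξ) ^ (α - 1) * Real.exp (l * ξ) =
      Real.exp (l * τ) * ∫ u in (0 : ℝ)..τ, u ^ (α - 1) * Real.exp (-(l * u)) := by
    have h2 := intervalIntegral.integral_comp_sub_left (a := 0) (b := τ)
      (fun u : ℝ => u ^ (α - 1) * Real.exp (-(l * u))) τ
    rw [sub_self, sub_zero] at h2
    rw [← h2, ← intervalIntegral.integral_const_mul]
    refine intervalIntegral.integral_congr fun ξ _ => ?_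
    have h3 : Real.exp (l * ξ) = Real.exp (l * τ) * Real.exp (-(l * (τ - ξ))) := by
      rw [← Real.exp_add]; ring_nf
    simp only [h3]
    ring
  rw [h1, ← Real.integral_rpow_mul_exp_neg_mul_Ioi hα hl, intervalIntegral.integral_of_le hτ]
  refine mul_le_mul_of_nonneg_left ?_ (Real.exp_pos _).le
  refine setIntegral_mono_set ?_ ?_ (Eventually.of_forall Ioc_subset_Ioi_self)
  -- A non-integrable function would have integral zero by convention, contradicting the positive
  -- value of the Gamma integral.
  · by_contra hcon
    have h4 := Real.integral_rpow_mul_exp_neg_mul_Ioi hα hl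
    rw [integral_undef hcon] at h4
    have := Real.Gamma_pos_of_pos hα
    have : 0 < (1 / l) ^ α * Real.Gamma α := by positivity
    linarith
  · refine (ae_restrict_iff' measurableSet_Ioi).2 (Eventually.of_forall fun u hu => ?_)
    have hu' : (0 : ℝ) < u := hu
    simp only [Pi.zero_apply]
    positivity

/-- A fractional Gronwall inequality. -/
theorem exists_norm_le_of_caputo_growth (hα : α ∈ Ioo (0 : ℝ) 1) (hT : 0 < T) {r A B : ℝ}
    (hr : 0 ≤ r) (hA : 0 ≤ A) (hB : 0 ≤ B) :
    ∃ R, 0 ≤ R ∧ ∀ x : ACFun n hT α, ‖x.1 ⟨0, left_mem_Icc.2 hT.le⟩‖ ≤ r →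
      (∀ᵐ τ : ℝ, τ ∈ Icc 0 T → ‖caputo hT α x.1 τ‖ ≤ A + B * ‖IccExtend hT.le x.1 τ‖) →
      ∀ τ, ‖x.1 τ‖ ≤ R := by
  have hα0 := hα.1
  have hΓ := Real.Gamma_pos_of_pos hα.1
  -- The rate makes `B / l^α < 1/2`, so in the norm weighted by `exp (-l τ)` the linear growth term
  -- can be absorbed.
  set l : ℝ := (2 * B + 1) ^ (1 / α) with hl_def
  have hl : 0 < l := by positivity
  have hlα : l ^ α = 2 * B + 1 := by
    rw [hl_def, ← Real.rpow_mul (by positivity), one_div_mul_cancel hα0.ne', Real.rpow_one]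
  refine ⟨2 * (r + A) * Real.exp (l * T), by positivity, fun x hx0 hx => ?_⟩
  have hne : Nonempty (Icc (0 : ℝ) T) := ⟨⟨0, left_mem_Icc.2 hT.le⟩⟩
  have hcont : Continuous fun τ : Icc (0 : ℝ) T => Real.exp (-(l * τ)) * ‖x.1 τ‖ := by fun_prop
  obtain ⟨m, hm⟩ := hcont.exists_forall_ge_of_hasCompactSupport
    (HasCompactSupport.of_compactSpace _)
  set S : ℝ := Real.exp (-(l * m)) * ‖x.1 m‖ with hS
  have hS0 : 0 ≤ S := by positivity
  have hxS : ∀ τ : Icc (0 : ℝ) T, ‖x.1 τ‖ ≤ S * Real.exp (l * τ) := fun τ => by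
    have h1 := mul_le_mul_of_nonneg_right (hm τ) (Real.exp_pos (l * τ)).le
    rwa [mul_right_comm, ← Real.exp_add, neg_add_cancel, Real.exp_zero, one_mul] at h1
  have hm0 : (0 : ℝ) ≤ m := m.2.1
  have hint : IntervalIntegrable (fun ξ : ℝ => (m - ξ) ^ (α - 1) * Real.exp (l * ξ)) volume 0 m :=
    (intervalIntegrable_kernel hα0 m 0 m).mul_continuousOn (by fun_prop)
  have h1 : ‖rlIntegral α (caputo hT α x.1) m‖ ≤
      (A + B * S) * (Real.exp (l * m) * (1 / l) ^ α) := by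
    rw [rlIntegral_eq _ hm0, norm_smul, Real.norm_of_nonneg (by positivity)]
    have h2 : ‖∫ ξ in (0 : ℝ)..m, (m - ξ) ^ (α - 1) • caputo hT α x.1 ξ‖ ≤
        ∫ ξ in (0 : ℝ)..m, (A + B * S) * ((m - ξ) ^ (α - 1) * Real.exp (l * ξ)) := by
      refine intervalIntegral.norm_integral_le_of_norm_le hm0 ?_ (hint.const_mul _)
      filter_upwards [hx] with ξ h3 hξ
      have hξT : ξ ∈ Icc 0 T := ⟨hξ.1.le, hξ.2.trans m.2.2⟩
      have h4 := h3 hξT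
      rw [IccExtend_of_mem hT.le _ hξT] at h4
      have h5 : ‖x.1 ⟨ξ, hξT⟩‖ ≤ S * Real.exp (l * ξ) := hxS ⟨ξ, hξT⟩
      have h6 : 1 ≤ Real.exp (l * ξ) := Real.one_le_exp (mul_nonneg hl.le hξ.1.le)
      have h0 : 0 ≤ (m - ξ) ^ (α - 1) := Real.rpow_nonneg (sub_nonneg.2 hξ.2) _
      rw [norm_smul, Real.norm_of_nonneg h0]
      have h7 : ‖caputo hT α x.1 ξ‖ ≤ (A + B * S) * Real.exp (l * ξ) := by
        calc _ ≤ A + B * ‖x.1 ⟨ξ, hξT⟩‖ := h4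
          _ ≤ A * Real.exp (l * ξ) + B * (S * Real.exp (l * ξ)) := by
            gcongr
            exact le_mul_of_one_le_right hA h6
          _ = _ := by ring
      calc _ ≤ (m - ξ) ^ (α - 1) * ((A + B * S) * Real.exp (l * ξ)) := by gcongr
        _ = _ := by ring
    rw [intervalIntegral.integral_const_mul] at h2
    have h8 := integral_kernel_mul_exp_le hα0 hl hm0
    calc _ ≤ 1 / Real.Gamma α * ((A + B * S) *
          (Real.exp (l * m) * ((1 / l) ^ α * Real.Gamma α))) := by
            gcongr
            exact h2.trans (by gcongr)
      _ = _ := by field_simp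
  have h9 : ‖x.1 m‖ ≤ r + (A + B * S) * (Real.exp (l * m) * (1 / l) ^ α) := by
    rw [x.2.eq_add_rlIntegral (hT := hT) hα m]
    exact (norm_add_le _ _).trans (add_le_add hx0 h1)
  have hexp : 1 ≤ Real.exp (l * m) := Real.one_le_exp (mul_nonneg hl.le hm0)
  have hq : (1 / l) ^ α = 1 / (2 * B + 1) := by
    rw [Real.div_rpow zero_le_one hl.le, Real.one_rpow, hlα]
  have h10 : S * Real.exp (l * m) = ‖x.1 m‖ := by
    rw [hS, mul_right_comm, ← Real.exp_add, neg_add_cancel, Real.exp_zero, one_mul]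
  -- The integral equation at the maximiser `m`, divided by `exp (l m)`.
  have h11 : S ≤ r + (A + B * S) * (1 / (2 * B + 1)) := by
    refine le_of_mul_le_mul_right (a := Real.exp (l * m)) ?_ (Real.exp_pos _)
    rw [h10]
    calc _ ≤ r * Real.exp (l * m) + (A + B * S) * (Real.exp (l * m) * (1 / l) ^ α) :=
          h9.trans (by gcongr; exact le_mul_of_one_le_right hr hexp)
      _ = _ := by rw [hq]; ring
  have h12 : S ≤ 2 * (r + A) := by
    have hpos : 0 < 2 * B + 1 := by positivity
    rw [mul_one_div, ← sub_le_iff_le_add', le_div_iff₀ hpos] at h11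
    nlinarith [mul_nonneg hB hr, mul_nonneg hB hA, mul_nonneg hB hS0]
  intro τ
  calc _ ≤ S * Real.exp (l * τ) := hxS τ
    _ ≤ _ := by
      gcongr
      exact τ.2.2

/-! ### Compactness -/

theorem ACFun.dist_le (hα : α ∈ Ioo (0 : ℝ) 1) {hT : 0 < T} (x : ACFun n hT α) {M : ℝ}
    (hM0 : 0 ≤ M) (hM : ∀ᵐ τ : ℝ, τ ∈ Icc 0 T → ‖caputo hT α x.1 τ‖ ≤ M) (s t : Icc (0 : ℝ) T) :
    dist (x.1 s) (x.1 t) ≤ 2 * M / (α * Real.Gamma α) * dist s t ^ α := by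
  obtain ⟨χ, h1, h2, h3⟩ := exists_measurable_bounded_eq_ae measurableSet_Icc hM0
    (measurable_caputo hT x.1).aestronglyMeasurable hM
  have heq : ∀ τ : Icc (0 : ℝ) T,
      rlIntegral α (caputo hT α x.1) τ = rlIntegral α χ τ := fun τ => by
    refine rlIntegral_congr_ae τ.2.1 ?_
    filter_upwards [h3] with ξ hξ hm
    exact hξ ⟨hm.1.le, hm.2.trans τ.2.2⟩
  rw [dist_eq_norm, x.2.eq_add_rlIntegral (hT := hT) hα s, x.2.eq_add_rlIntegral (hT := hT) hα t,
    add_sub_add_left_eq_sub, heq, heq, Subtype.dist_eq, Real.dist_eq]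
  exact norm_rlIntegral_sub_le hα h1 h2 t.2.1 s.2.1

theorem ACFun.norm_caputoPrimitive_sub_le (hα : α ∈ Ioo (0 : ℝ) 1) {hT : 0 < T} (x : ACFun n hT α)
    {M : ℝ} (hM : ∀ᵐ τ : ℝ, τ ∈ Icc 0 T → ‖caputo hT α x.1 τ‖ ≤ M) {a b : ℝ} (ha : a ∈ Icc 0 T)
    (hb : b ∈ Icc 0 T) :
    ‖caputoPrimitive hT α x.1 b - caputoPrimitive hT α x.1 a‖ ≤ M * |b - a| := by
  rw [← (x.2.integral_caputo hα ha hb).2]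
  refine intervalIntegral.norm_integral_le_of_norm_le_const_ae ?_
  filter_upwards [hM] with τ h hτ
  exact h ((uIoc_subset_uIcc.trans (uIcc_subset_Icc ha hb)) hτ)

theorem caputoPrimitive_sub (hα : α ∈ Ioo (0 : ℝ) 1) (hT : 0 < T) (x y : C(Icc (0 : ℝ) T, Vec n))
    {τ : ℝ} (hτ : 0 ≤ τ) :
    caputoPrimitive hT α (x - y) τ = caputoPrimitive hT α x τ - caputoPrimitive hT α y τ := by
  have hα' : 0 < 1 - α := sub_pos.2 hα.2
  have hint := fun z : C(Icc (0 : ℝ) T, Vec n) => intervalIntegrable_kernel_smul hα'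
    (continuous_increment hT z).measurable (norm_increment_le hT z) τ 0 τ
  simp only [caputoPrimitive]
  rw [rlIntegral_eq _ hτ, rlIntegral_eq _ hτ, rlIntegral_eq _ hτ, ← smul_sub,
    ← intervalIntegral.integral_sub (hint x) (hint y)]
  congr 1
  refine intervalIntegral.integral_congr fun ξ _ => ?_
  simp only [← smul_sub]
  congr 1
  simp only [increment, IccExtend, Function.comp, ContinuousMap.sub_apply]
  abel

/-- `I^{1-α}` is bounded for the maximum norm, so integrals of Caputo derivatives converge even when
the derivatives do not. -/
theorem tendsto_caputoPrimitive (hα : α ∈ Ioo (0 : ℝ) 1) (hT : 0 < T)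
    {x : ℕ → C(Icc (0 : ℝ) T, Vec n)} {y : C(Icc (0 : ℝ) T, Vec n)} (h : Tendsto x atTop (𝓝 y))
    {τ : ℝ} (hτ : 0 ≤ τ) : Tendsto (fun k => caputoPrimitive hT α (x k) τ) atTop
      (𝓝 (caputoPrimitive hT α y τ)) := by
  have hα' : 0 < 1 - α := sub_pos.2 hα.2
  rw [tendsto_iff_norm_sub_tendsto_zero] at h ⊢
  have hlim := (h.const_mul 2).mul_const (τ ^ (1 - α) / ((1 - α) * Real.Gamma (1 - α)))
  rw [mul_zero, zero_mul] at hlim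
  refine squeeze_zero (fun _ => norm_nonneg _) (fun k => ?_) hlim
  rw [← caputoPrimitive_sub hα hT _ _ hτ]
  exact norm_rlIntegral_le hα' hτ fun ξ _ => norm_increment_le hT _ ξ

theorem isAC_of_tendsto (hα : α ∈ Ioo (0 : ℝ) 1) {hT : 0 < T} {x : ℕ → ACFun n hT α} {M : ℝ}
    (hM0 : 0 ≤ M) (hM : ∀ k, ∀ᵐ τ : ℝ, τ ∈ Icc 0 T → ‖caputo hT α (x k).1 τ‖ ≤ M)
    {y : C(Icc (0 : ℝ) T, Vec n)} (h : Tendsto (fun k => (x k).1) atTop (𝓝 y)) :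
    IsAC α hT.le y := by
  refine isAC_of_lipschitzOn_caputoPrimitive hα hT (K := ⟨M, hM0⟩)
    (LipschitzOnWith.of_dist_le_mul fun a ha b hb => ?_)
  rw [dist_eq_norm, Real.dist_eq]
  exact le_of_tendsto (((tendsto_caputoPrimitive hα hT h ha.1).sub
    (tendsto_caputoPrimitive hα hT h hb.1)).norm)
    (Eventually.of_forall fun k => (x k).norm_caputoPrimitive_sub_le hα (hM k) hb ha)

/-- Arzelà–Ascoli with the Hölder modulus determined by `M`; the limit stays in `AC^α` because the
primitives are uniformly `M`-Lipschitz. -/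
theorem exists_subseq_tendsto (hα : α ∈ Ioo (0 : ℝ) 1) {hT : 0 < T} {x : ℕ → ACFun n hT α}
    {M R : ℝ} (hM0 : 0 ≤ M)
    (hM : ∀ k, ∀ᵐ τ : ℝ, τ ∈ Icc 0 T → ‖caputo hT α (x k).1 τ‖ ≤ M)
    (hR : ∀ k τ, ‖(x k).1 τ‖ ≤ R) :
    ∃ y : ACFun n hT α, ∃ θ : ℕ → ℕ, StrictMono θ ∧
      Tendsto (fun k => (x (θ k)).1) atTop (𝓝 y.1) := by
  set F : ℕ → BoundedContinuousFunction (Icc (0 : ℝ) T) (Vec n) :=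
    fun k => BoundedContinuousFunction.mkOfCompact (x k).1 with hF
  have hcomp : IsCompact (closure (range F)) := by
    refine BoundedContinuousFunction.arzela_ascoli (Metric.closedBall 0 R)
      (isCompact_closedBall 0 R) _ ?_ ?_
    · rintro _ τ ⟨k, rfl⟩
      rw [mem_closedBall_zero_iff]
      exact hR k τ
    · refine Metric.equicontinuous_of_continuity_modulus
        (fun d => 2 * M / (α * Real.Gamma α) * d ^ α) ?_ _ ?_
      · have hc : Continuous fun d : ℝ => 2 * M / (α * Real.Gamma α) * d ^ α :=
          continuous_const.mul (Real.continuous_rpow_const hα.1.le)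
        have h := hc.tendsto 0
        rwa [Real.zero_rpow hα.1.ne', mul_zero] at h
      · rintro s t ⟨_, k, rfl⟩
        exact (x k).dist_le hα hM0 (hM k) s t
  obtain ⟨f, -, θ, hθ, hlim⟩ := hcomp.tendsto_subseq fun k => subset_closure (mem_range_self k)
  have hlim' : Tendsto (fun k => (x (θ k)).1) atTop (𝓝 f.toContinuousMap) := by
    rw [tendsto_iff_dist_tendsto_zero] at hlim ⊢
    exact hlim
  exact ⟨⟨_, isAC_of_tendsto hα hM0 (fun k => hM (θ k)) hlim'⟩, θ, hθ, hlim'⟩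

theorem distStar_restr_le {hT : 0 < T} (x y : ACFun n hT α) (t : Icc (0 : ℝ) T) :
    Path.distStar (x.restr t).1 (y.restr t).1 ≤ dist x.1 y.1 := by
  refine ciSup_le fun τ =>
    (ciInf_le (Path.bddBelow_ptDist (x.restr t).1 (y.restr t).1 τ) τ).trans ?_
  have h : Path.ptDist (x.restr t).1 (y.restr t).1 τ τ =
      dist (x.1 ⟨τ, τ.2.1, τ.2.2.trans t.2.2⟩) (y.1 ⟨τ, τ.2.1, τ.2.2.trans t.2.2⟩) := by
    rw [dist_eq_norm]
    unfold Path.ptDist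
    rw [sub_self, abs_zero, zero_pow two_ne_zero, zero_add, Real.sqrt_sq (norm_nonneg _)]
    rfl
  exact h.trans_le (ContinuousMap.dist_apply_le_dist _)

theorem tendsto_restr {hT : 0 < T} {x : ℕ → ACFun n hT α} {y : ACFun n hT α}
    (h : Tendsto (fun k => (x k).1) atTop (𝓝 y.1)) (t : Icc (0 : ℝ) T) :
    Tendsto (fun k => (x k).restr t) atTop (𝓝 (y.restr t)) := by
  rw [tendsto_iff_dist_tendsto_zero] at h ⊢
  refine squeeze_zero (fun _ => dist_nonneg) (fun k => ?_) h
  exact max_le (distStar_restr_le _ _ t)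
    ((distStar_restr_le _ _ t).trans_eq (dist_comm _ _))

end

/-! ### Propagation along characteristics -/

section

variable {T : ℝ} {α : ℝ}

/-- The increment over `[a, b]` of the second component of a characteristic with first
component `x`, where `L = H(·, ·, v)`. -/
def charIncrement (hT : 0 < T) (α : ℝ) (L : ℝ → Vec n → ℝ) (v : Vec n)
    (x : C(Icc (0 : ℝ) T, Vec n)) (a b : ℝ) : ℝ :=
  inner ℝ v (caputoPrimitive hT α x b - caputoPrimitive hT α x a)
    - ∫ τ in a..b, L τ (IccExtend hT.le x τ)

/-- `‖(ᶜD^α x)(τ)‖ ≤ cH (1 + ‖x(τ)‖)` for a.e. `τ ∈ [a, T]`. -/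
def HasCaputoGrowth (hT : 0 < T) (α cH : ℝ) (x : C(Icc (0 : ℝ) T, Vec n)) (a : ℝ) : Prop :=
  ∀ᵐ τ : ℝ, τ ∈ Icc 0 T → a ≤ τ → ‖caputo hT α x τ‖ ≤ cH * (1 + ‖IccExtend hT.le x τ‖)

/-- The stability property of upper solutions, with the second component of the characteristic
eliminated. -/
def IsStable (hT : 0 < T) (cH : ℝ) (L : ℝ → Vec n → ℝ) (v : Vec n) (φ : ACPath n T α → ℝ) :
    Prop :=
  ∀ p : ACPath n T α, (p.1.time : ℝ) < T → ∀ t : Icc (0 : ℝ) T, p.1.time < t → ∀ ε > 0,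
    ∃ x : ACFun n hT α, IsExtension p x ∧ HasCaputoGrowth hT α cH x.1 p.1.time ∧
      φ (x.restr t) - charIncrement hT α L v x.1 p.1.time t ≤ φ p + ε

theorem continuous_along {L : ℝ → Vec n → ℝ} (hL : Continuous fun q : ℝ × Vec n => L q.1 q.2)
    (hT : 0 < T) (x : C(Icc (0 : ℝ) T, Vec n)) :
    Continuous fun τ => L τ (IccExtend hT.le x τ) :=
  hL.comp (continuous_id.prodMk (x.continuous.Icc_extend' (h := hT.le)))

theorem charIncrement_self (hT : 0 < T) (L : ℝ → Vec n → ℝ) (v : Vec n)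
    (x : C(Icc (0 : ℝ) T, Vec n)) (a : ℝ) : charIncrement hT α L v x a a = 0 := by
  simp [charIncrement]

theorem charIncrement_add {L : ℝ → Vec n → ℝ} (hL : Continuous fun q : ℝ × Vec n => L q.1 q.2)
    (hT : 0 < T) (v : Vec n) (x : C(Icc (0 : ℝ) T, Vec n)) (a b c : ℝ) :
    charIncrement hT α L v x a b + charIncrement hT α L v x b c =
      charIncrement hT α L v x a c := by
  have hc := continuous_along hL hT x
  simp only [charIncrement]
  rw [← intervalIntegral.integral_add_adjacent_intervals (hc.intervalIntegrable a b)
    (hc.intervalIntegrable b c)]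
  simp only [inner_sub_right]
  ring

theorem charIncrement_congr (hT : 0 < T) (L : ℝ → Vec n → ℝ) (v : Vec n)
    {x y : C(Icc (0 : ℝ) T, Vec n)} {c : ℝ} (hc : c ∈ Icc 0 T)
    (h : ∀ τ : Icc (0 : ℝ) T, (τ : ℝ) ≤ c → x τ = y τ) {a b : ℝ} (ha : a ∈ Icc 0 c)
    (hb : b ∈ Icc 0 c) : charIncrement hT α L v x a b = charIncrement hT α L v y a b := by
  simp only [charIncrement]
  rw [caputoPrimitive_congr hT hc h ha, caputoPrimitive_congr hT hc h hb]
  congr 1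
  refine intervalIntegral.integral_congr fun τ hτ => ?_
  have hτc : τ ∈ Icc 0 c := uIcc_subset_Icc ha hb hτ
  have hτT : τ ∈ Icc 0 T := ⟨hτc.1, hτc.2.trans hc.2⟩
  simp only [IccExtend_of_mem hT.le _ hτT]
  rw [h _ hτc.2]

theorem restr_congr {hT : 0 < T} {x y : ACFun n hT α} {t : Icc (0 : ℝ) T}
    (h : ∀ τ : Icc (0 : ℝ) T, (τ : ℝ) ≤ t → x.1 τ = y.1 τ) : x.restr t = y.restr t := by
  refine Subtype.ext ?_
  simp only [ACFun.restr]
  congr 1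
  ext1 τ
  exact h _ τ.2.2

theorem IsExtension.eq_of_le {hT : 0 < T} {p : ACPath n T α} {x y : ACFun n hT α}
    (hx : IsExtension p x) (hy : IsExtension p y) (τ : Icc (0 : ℝ) T)
    (hτ : (τ : ℝ) ≤ p.1.time) : x.1 τ = y.1 τ :=
  (hx ⟨τ, τ.2.1, hτ⟩).trans (hy ⟨τ, τ.2.1, hτ⟩).symm

theorem IsExtension.restr_eq {hT : 0 < T} {p : ACPath n T α} {x : ACFun n hT α}
    (hx : IsExtension p x) : x.restr p.1.time = p := by
  refine Subtype.ext ?_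
  obtain ⟨⟨t, w⟩, hw⟩ := p
  simp only [ACFun.restr]
  congr 1
  ext1 τ
  exact hx τ

/-- Induction on the largest time: stability is restarted from the path reached at the previous
largest time. By causality the earlier inequalities survive, and the increments add along the
concatenation. -/
theorem exists_extension_forall_mem_finset {hT : 0 < T} {cH : ℝ} {L : ℝ → Vec n → ℝ}
    (hL : Continuous fun q : ℝ × Vec n => L q.1 q.2) {v : Vec n} {φ : ACPath n T α → ℝ}
    (hφ : IsStable hT cH L v φ) {p : ACPath n T α} (hp : (p.1.time : ℝ) < T)
    (F : Finset (Icc (0 : ℝ) T)) (hF : ∀ t ∈ F, p.1.time < t) {ε : ℝ} (hε : 0 < ε) :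
    ∃ x : ACFun n hT α, IsExtension p x ∧ HasCaputoGrowth hT α cH x.1 p.1.time ∧
      ∀ t ∈ F, φ (x.restr t) - charIncrement hT α L v x.1 p.1.time t ≤ φ p + ε := by
  induction F using Finset.induction_on_max generalizing ε with
  | empty =>
    -- Stability at time `T` is used only to produce some extension with the growth bound.
    obtain ⟨x, h1, h2, -⟩ := hφ p hp ⟨T, right_mem_Icc.2 hT.le⟩ hp ε hε
    exact ⟨x, h1, h2, by simp⟩
  | insert t F hmax ih =>
    obtain ⟨x, hx, hgx, hFx⟩ := ih (fun s hs => hF s (Finset.mem_insert_of_mem hs)) (half_pos hε)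
    -- The restart time is the largest element of `F`, or the initial time if `F` is empty.
    obtain ⟨b, hpb, hbt, hFb, hb⟩ : ∃ b : Icc (0 : ℝ) T, p.1.time ≤ b ∧ b < t ∧
        (∀ s ∈ F, s ≤ b) ∧
        φ (x.restr b) - charIncrement hT α L v x.1 p.1.time b ≤ φ p + ε / 2 := by
      rcases F.eq_empty_or_nonempty with rfl | hne
      · refine ⟨p.1.time, le_rfl, hF t (by simp), by simp, ?_⟩
        rw [hx.restr_eq, charIncrement_self]
        linarith
      · have hmem := F.max'_mem hne
        exact ⟨F.max' hne, (hF _ (Finset.mem_insert_of_mem hmem)).le, hmax _ hmem,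
          fun s hs => F.le_max' s hs, hFx _ hmem⟩
    have hbT : (b : ℝ) < T := lt_of_lt_of_le hbt t.2.2
    obtain ⟨y, hy, hgy, hty⟩ := hφ (x.restr b) hbT t hbt (ε / 2) (half_pos hε)
    have hxy : ∀ τ : Icc (0 : ℝ) T, (τ : ℝ) ≤ b → y.1 τ = x.1 τ := fun τ hτ =>
      hy ⟨τ, τ.2.1, hτ⟩
    have hpb' : (p.1.time : ℝ) ∈ Icc 0 (b : ℝ) := ⟨p.1.time.2.1, hpb⟩
    refine ⟨y, fun τ => ?_, ?_, fun s hs => ?_⟩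
    · rw [hxy _ (τ.2.2.trans hpb)]
      exact hx τ
    · filter_upwards [hgx, hgy, Measure.ae_ne volume 0] with τ h1 h2 h0 hτ hpτ
      rcases lt_or_ge τ (b : ℝ) with hlt | hge
      · have h3 := h1 hτ hpτ
        rw [caputo_congr hT b.2 hxy ⟨lt_of_le_of_ne hτ.1 h0.symm, hlt⟩,
          IccExtend_of_mem hT.le _ hτ, hxy _ hlt.le]
        rwa [IccExtend_of_mem hT.le _ hτ] at h3
      · exact h2 hτ hge
    · rcases Finset.mem_insert.1 hs with rfl | hs
      · have h1 : φ (y.restr s) - charIncrement hT α L v y.1 b s ≤ φ (x.restr b) + ε / 2 := hty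
        rw [← charIncrement_add hL hT v y.1 p.1.time b s,
          charIncrement_congr hT L v b.2 hxy hpb' ⟨b.2.1, le_rfl⟩]
        linarith
      · have hsb : (s : ℝ) ≤ b := hFb s hs
        rw [restr_congr fun τ hτ => hxy τ (hτ.trans hsb),
          charIncrement_congr hT L v b.2 hxy hpb' ⟨s.2.1, hsb⟩]
        linarith [hFx s hs]

theorem tendsto_charIncrement (hα : α ∈ Ioo (0 : ℝ) 1) (hT : 0 < T) {L : ℝ → Vec n → ℝ}
    (hL : Continuous fun q : ℝ × Vec n => L q.1 q.2) (v : Vec n)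
    {x : ℕ → C(Icc (0 : ℝ) T, Vec n)} {y : C(Icc (0 : ℝ) T, Vec n)} (h : Tendsto x atTop (𝓝 y))
    {R : ℝ} (hR : ∀ k τ, ‖x k τ‖ ≤ R) {a b : ℝ} (ha : 0 ≤ a) (hb : 0 ≤ b) :
    Tendsto (fun k => charIncrement hT α L v (x k) a b) atTop
      (𝓝 (charIncrement hT α L v y a b)) := by
  refine Tendsto.sub (tendsto_const_nhds.inner ((tendsto_caputoPrimitive hα hT h hb).sub
    (tendsto_caputoPrimitive hα hT h ha))) ?_
  obtain ⟨C, hC⟩ := ((isCompact_uIcc (a := a) (b := b)).prod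
    (isCompact_closedBall (0 : Vec n) R)).exists_bound_of_continuousOn hL.continuousOn
  refine intervalIntegral.tendsto_integral_filter_of_dominated_convergence (fun _ => C)
    (Eventually.of_forall fun k => (continuous_along hL hT (x k)).aestronglyMeasurable)
    (Eventually.of_forall fun k => Eventually.of_forall fun τ hτ => ?_)
    intervalIntegrable_const (Eventually.of_forall fun τ _ => ?_)
  · refine hC (τ, IccExtend hT.le (x k) τ) ⟨uIoc_subset_uIcc hτ, ?_⟩
    rw [mem_closedBall_zero_iff]
    exact hR k _
  · have hpt : Tendsto (fun k => IccExtend hT.le (x k) τ) atTop (𝓝 (IccExtend hT.le y τ)) :=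
      ((continuous_eval_const (projIcc 0 T hT.le τ)).tendsto y).comp h
    exact (hL.tendsto (τ, IccExtend hT.le y τ)).comp (tendsto_const_nhds.prodMk_nhds hpt)

/-- The `k`-th approximation handles the times `t 0, …, t k` with error `1 / (k + 1)`. A uniform
limit of a subsequence satisfies every inequality without error, by lower semicontinuity of `φ` and
continuity of the increment. -/
theorem exists_extension_forall_seq (hα : α ∈ Ioo (0 : ℝ) 1) {hT : 0 < T} {cH : ℝ} (hcH : 0 < cH)
    {L : ℝ → Vec n → ℝ} (hL : Continuous fun q : ℝ × Vec n => L q.1 q.2) {v : Vec n}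
    {φ : ACPath n T α → ℝ} (hlsc : LowerSemicontinuous φ) (hφ : IsStable hT cH L v φ)
    {p : ACPath n T α} (hp : (p.1.time : ℝ) < T) (t : ℕ → Icc (0 : ℝ) T)
    (ht : ∀ j, p.1.time < t j) :
    ∃ y : ACFun n hT α, IsExtension p y ∧
      ∀ j, φ (y.restr (t j)) - charIncrement hT α L v y.1 p.1.time (t j) ≤ φ p := by
  classical
  have hex : ∀ k : ℕ, ∃ x : ACFun n hT α, IsExtension p x ∧
      HasCaputoGrowth hT α cH x.1 p.1.time ∧ ∀ j ≤ k,
        φ (x.restr (t j)) - charIncrement hT α L v x.1 p.1.time (t j) ≤ φ p + 1 / (k + 1) := by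
    intro k
    obtain ⟨x, h1, h2, h3⟩ := exists_extension_forall_mem_finset hL hφ hp
      ((Finset.range (k + 1)).image t) (by simp only [Finset.mem_image]; grind)
      (Nat.one_div_pos_of_nat (α := ℝ) (n := k))
    exact ⟨x, h1, h2, fun j hj => h3 _ (Finset.mem_image_of_mem t (by simp; omega))⟩
  choose x hx hg hstab using hex
  -- All `x k` share the same past up to the initial time, so one bound taken from `x 0` serves
  -- there for every `k`.
  obtain ⟨A, hA0, hA⟩ := (x 0).2.ae_norm_caputo_le (hT := hT) hα
  have hgrow : ∀ k, ∀ᵐ τ : ℝ, τ ∈ Icc 0 T →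
      ‖caputo hT α (x k).1 τ‖ ≤ (A + cH) + cH * ‖IccExtend hT.le (x k).1 τ‖ := fun k => by
    filter_upwards [hA, hg k, Measure.ae_ne volume 0] with τ h1 h2 h0 hτ
    rcases lt_or_ge τ (p.1.time : ℝ) with hlt | hge
    · rw [caputo_congr hT p.1.time.2 (fun s hs => (hx k).eq_of_le (hx 0) s hs)
        ⟨lt_of_le_of_ne hτ.1 h0.symm, hlt⟩]
      have h3 : 0 ≤ cH * ‖IccExtend hT.le (x k).1 τ‖ := by positivity
      linarith [h1 hτ]
    · linarith [h2 hτ hge]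
  obtain ⟨R, hR0, hR⟩ := exists_norm_le_of_caputo_growth (n := n) hα hT
    (norm_nonneg ((x 0).1 ⟨0, left_mem_Icc.2 hT.le⟩)) (add_nonneg hA0 hcH.le) hcH.le
  have hRx : ∀ k τ, ‖(x k).1 τ‖ ≤ R := fun k => hR (x k)
    (le_of_eq (by rw [(hx k).eq_of_le (hx 0) _ p.1.time.2.1])) (hgrow k)
  have hM : ∀ k, ∀ᵐ τ : ℝ, τ ∈ Icc 0 T → ‖caputo hT α (x k).1 τ‖ ≤ (A + cH) + cH * R := fun k => by
    filter_upwards [hgrow k] with τ h1 hτ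
    refine (h1 hτ).trans ?_
    gcongr
    exact hRx k _
  obtain ⟨y, θ, hθ, hlim⟩ := exists_subseq_tendsto hα (by positivity) hM hRx
  refine ⟨y, fun τ => ?_, fun j => ?_⟩
  · have h1 := ((continuous_eval_const
      (inclusion (Icc_subset_Icc_right p.1.time.2.2) τ)).tendsto y.1).comp hlim
    refine tendsto_nhds_unique h1 ?_
    refine tendsto_const_nhds.congr fun k => ?_
    exact (hx (θ k) τ).symm
  · have hinc := tendsto_charIncrement hα hT hL v hlim (fun k => hRx (θ k)) p.1.time.2.1 (t j).2.1
    have herr : Tendsto (fun k => (1 : ℝ) / ((θ k : ℝ) + 1)) atTop (𝓝 0) :=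
      tendsto_one_div_add_atTop_nhds_zero_nat.comp hθ.tendsto_atTop
    have hrhs := (hinc.add_const (φ p)).add herr
    rw [add_zero] at hrhs
    rw [sub_le_iff_le_add']
    refine le_of_forall_lt fun c hc => ?_
    obtain ⟨c', hcc', hc'⟩ := exists_between hc
    refine hcc'.trans_le (ge_of_tendsto hrhs ?_)
    filter_upwards [(tendsto_restr hlim (t j)).eventually (hlsc _ c' hc'), eventually_ge_atTop j]
      with k h1 h2
    have h3 := hstab (θ k) j (h2.trans (hθ.id_le k))
    linarith

/-- The Hamilton–Jacobi inequality satisfied by stable functionals at points of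
`ci`-differentiability. -/
theorem add_le_zero_of_isStable (hα : α ∈ Ioo (0 : ℝ) 1) {hT : 0 < T} {cH : ℝ} (hcH : 0 < cH)
    {L : ℝ → Vec n → ℝ} (hL : Continuous fun q : ℝ × Vec n => L q.1 q.2) {v : Vec n}
    {φ : ACPath n T α → ℝ} (hlsc : LowerSemicontinuous φ) (hφ : IsStable hT cH L v φ)
    {p : ACPath n T α} (hp : (p.1.time : ℝ) < T) {a : ℝ} (hd : HasCiDerivAt hT φ p a v) :
    a + L p.1.time p.endValue ≤ 0 := by
  set t₀ : ℝ := (p.1.time : ℝ) with ht₀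
  have hpos : 0 < T - t₀ := sub_pos.2 hp
  have hδ : ∀ j : ℕ, (T - t₀) * (1 / ((j : ℝ) + 1)) ≤ T - t₀ := fun j =>
    mul_le_of_le_one_right hpos.le (by
      rw [div_le_one (by positivity)]
      linarith [(Nat.cast_nonneg j : (0 : ℝ) ≤ j)])
  have hδ0 : ∀ j : ℕ, 0 < (T - t₀) * (1 / ((j : ℝ) + 1)) := fun j => by positivity
  set t : ℕ → Icc (0 : ℝ) T := fun j => ⟨t₀ + (T - t₀) * (1 / ((j : ℝ) + 1)),
    by linarith [p.1.time.2.1, hδ0 j], by linarith [hδ j]⟩ with ht_def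
  have ht : ∀ j, p.1.time < t j := fun j => by
    rw [← Subtype.coe_lt_coe]
    simp only [ht_def]
    linarith [hδ0 j]
  have htreal : Tendsto (fun j => (t j : ℝ)) atTop (𝓝 t₀) := by
    have h := ((tendsto_one_div_add_atTop_nhds_zero_nat (𝕜 := ℝ)).const_mul (T - t₀)).const_add t₀
    rwa [mul_zero, add_zero] at h
  have htlim : Tendsto t atTop (𝓝[>] p.1.time) :=
    tendsto_nhdsWithin_iff.2 ⟨tendsto_subtype_rng.2 htreal, Eventually.of_forall ht⟩
  -- One extension for the entire sequence, so the `o(t - t₀)` of the `ci`-expansion applies along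
  -- it.
  obtain ⟨y, hy, hineq⟩ := exists_extension_forall_seq hα hcH hL hlsc hφ hp t ht
  have hcont := continuous_along hL hT y.1
  have hend : IccExtend hT.le y.1 t₀ = p.endValue := by
    rw [IccExtend_of_mem hT.le _ p.1.time.2]
    exact hy ⟨t₀, right_mem_Icc.2 p.1.time.2.1⟩
  have hderiv : HasDerivAt (fun s => ∫ τ in t₀..s, L τ (IccExtend hT.le y.1 τ))
      (L t₀ p.endValue) t₀ := by
    rw [← hend]
    exact intervalIntegral.integral_hasDerivAt_right (hcont.intervalIntegrable _ _)
      hcont.stronglyMeasurable.stronglyMeasurableAtFilter hcont.continuousAt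
  have hne : ∀ᶠ j in atTop, (t j : ℝ) ∈ ({t₀}ᶜ : Set ℝ) :=
    Eventually.of_forall fun j => (Subtype.coe_lt_coe.2 (ht j)).ne'
  have havg := (hasDerivAt_iff_tendsto_slope.1 hderiv).comp
    (tendsto_nhdsWithin_iff.2 ⟨htreal, hne⟩)
  have hsmall := ((hd y hy).comp_tendsto htlim).tendsto_div_nhds_zero
  have hlim := (hsmall.add_const a).add havg
  rw [zero_add] at hlim
  -- In each quotient `a` cancels, leaving the numerator `φ(y_t) - φ(p) - charIncrement`, which is
  -- nonpositive.
  refine le_of_tendsto hlim (Eventually.of_forall fun j => ?_)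
  have hj : 0 < (t j : ℝ) - t₀ := sub_pos.2 (Subtype.coe_lt_coe.2 (ht j))
  obtain ⟨hint, hprim⟩ := y.2.integral_caputo (hT := hT) hα p.1.time.2 (t j).2
  have hinner : ∫ τ in t₀..(t j : ℝ), inner ℝ v (caputo hT α y.1 τ) =
      inner ℝ v (caputoPrimitive hT α y.1 (t j) - caputoPrimitive hT α y.1 t₀) := by
    rw [← hprim]
    exact (innerSL ℝ v).intervalIntegral_comp_comm hint
  have h1 := hineq j
  simp only [charIncrement] at h1
  simp only [Function.comp, slope_def_field, intervalIntegral.integral_same, sub_zero]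
  rw [div_add' _ _ _ hj.ne', ← add_div]
  refine div_nonpos_of_nonpos_of_nonneg ?_ hj.le
  rw [hinner]
  linarith

/-! ### Reduction of upper and lower solutions to stable functionals -/

theorem HasCiDerivAt.neg {hT : 0 < T} {φ : ACPath n T α → ℝ} {p : ACPath n T α} {a : ℝ} {v : Vec n}
    (hd : HasCiDerivAt hT φ p a v) : HasCiDerivAt hT (fun q => -φ q) p (-a) (-v) := by
  intro x hx
  refine (hd x hx).neg_left.congr_left fun t => ?_
  simp only [inner_neg_left, intervalIntegral.integral_neg]
  ring

/-- A Lipschitz `z` is the integral of its derivative, which the characteristic inclusion prescribes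
in terms of `x`; this eliminates `z`. -/
theorem characteristics_snd_eq (hα : α ∈ Ioo (0 : ℝ) 1) {hT : 0 < T} {cH : ℝ}
    {H : Icc (0 : ℝ) T → Vec n → Vec n → ℝ} {p : ACPath n T α} {s : Vec n}
    (hL : Continuous fun q : ℝ × Vec n => H (projIcc 0 T hT.le q.1) q.2 s)
    {xz : ACFun n hT α × C(Icc (0 : ℝ) T, ℝ)} (h : xz ∈ characteristics hT cH H p 0 s)
    {t : Icc (0 : ℝ) T} (ht : p.1.time ≤ t) :
    HasCaputoGrowth hT α cH xz.1.1 p.1.time ∧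
      xz.2 t = charIncrement hT α (fun τ x => H (projIcc 0 T hT.le τ) x s) s xz.1.1
        p.1.time t := by
  obtain ⟨-, ⟨K, hK⟩, hz, hae⟩ := h
  constructor
  · filter_upwards [hae] with τ h1 hτ hpτ
    rw [IccExtend_of_mem hT.le _ hτ]
    exact (h1 hτ hpτ).1
  · have hlip : LipschitzWith K (IccExtend hT.le xz.2) := by
      have h := hK.comp (LipschitzWith.projIcc hT.le)
      rwa [mul_one] at h
    have h1 := integral_deriv_eq_sub_of_lipschitzWith hlip p.1.time t
    rw [IccExtend_of_mem hT.le _ t.2, IccExtend_of_mem hT.le _ p.1.time.2, hz p.1.time le_rfl,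
      sub_zero] at h1
    obtain ⟨hint, hprim⟩ := xz.1.2.integral_caputo (hT := hT) hα p.1.time.2 t.2
    have hcomm := (innerSL ℝ s).intervalIntegral_comp_comm hint
    simp only [innerSL_apply_apply] at hcomm
    have hinner : IntervalIntegrable (fun τ => inner ℝ s (caputo hT α xz.1.1 τ)) volume
        p.1.time t :=
      ⟨(innerSL ℝ s).integrable_comp hint.1, (innerSL ℝ s).integrable_comp hint.2⟩
    have hcont := continuous_along (L := fun τ x => H (projIcc 0 T hT.le τ) x s) hL hT xz.1.1
    rw [charIncrement, ← hprim, ← hcomm, ← intervalIntegral.integral_sub hinner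
      (hcont.intervalIntegrable _ _)]
    refine h1.symm.trans (intervalIntegral.integral_congr_ae ?_)
    filter_upwards [hae] with τ h2 hτ
    rw [uIoc_of_le (by exact ht)] at hτ
    have hτT : τ ∈ Icc 0 T := ⟨p.1.time.2.1.trans hτ.1.le, hτ.2.trans t.2.2⟩
    rw [IccExtend_of_mem hT.le _ hτT, projIcc_of_mem hT.le hτT]
    exact (h2 hτT hτ.1.le).2

theorem charIncrement_neg (hT : 0 < T) (L : ℝ → Vec n → ℝ) (v : Vec n)
    (x : C(Icc (0 : ℝ) T, Vec n)) (a b : ℝ) :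
    charIncrement hT α (fun τ y => -L τ y) (-v) x a b = -charIncrement hT α L v x a b := by
  simp only [charIncrement, inner_neg_left, intervalIntegral.integral_neg]
  ring

theorem IsUpperSolution.isStable (hα : α ∈ Ioo (0 : ℝ) 1) {hT : 0 < T} {cH : ℝ}
    {H : Icc (0 : ℝ) T → Vec n → Vec n → ℝ} {σ : ACFun n hT α → ℝ} {φ : ACPath n T α → ℝ}
    (hφ : IsUpperSolution hT cH H σ φ) {s : Vec n}
    (hL : Continuous fun q : ℝ × Vec n => H (projIcc 0 T hT.le q.1) q.2 s) :
    IsStable hT cH (fun τ x => H (projIcc 0 T hT.le τ) x s) s φ := by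
  intro p hp t ht ε hε
  obtain ⟨xz, hxz, h⟩ := hφ.stable p hp t ht s ε hε
  obtain ⟨hg, hz⟩ := characteristics_snd_eq hα hL hxz ht.le
  exact ⟨xz.1, hxz.1, hg, hz ▸ h⟩

/-- Changing the sign of `φ`, `H` and `s` negates the increment and leaves the growth bound on `ᶜD^α
x` unchanged, so one argument covers both kinds of solution. -/
theorem IsLowerSolution.isStable_neg (hα : α ∈ Ioo (0 : ℝ) 1) {hT : 0 < T} {cH : ℝ}
    {H : Icc (0 : ℝ) T → Vec n → Vec n → ℝ} {σ : ACFun n hT α → ℝ} {φ : ACPath n T α → ℝ}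
    (hφ : IsLowerSolution hT cH H σ φ) {s : Vec n}
    (hL : Continuous fun q : ℝ × Vec n => H (projIcc 0 T hT.le q.1) q.2 s) :
    IsStable hT cH (fun τ x => -H (projIcc 0 T hT.le τ) x s) (-s) (fun q => -φ q) := by
  intro p hp t ht ε hε
  obtain ⟨xz, hxz, h⟩ := hφ.stable p hp t ht s ε hε
  obtain ⟨hg, hz⟩ := characteristics_snd_eq hα hL hxz ht.le
  refine ⟨xz.1, hxz.1, hg, ?_⟩
  rw [charIncrement_neg hT (fun τ x => H (projIcc 0 T hT.le τ) x s), ← hz]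
  linarith

end

end FracHJ

end

/-! ### The Hamilton–Jacobi equation from the two inequalities -/

theorem mainTheorem4 (n : ℕ) (T : ℝ) (hT : 0 < T) (α : ℝ) (hα : α ∈ Set.Ioo (0 : ℝ) 1)
    (H : Set.Icc (0 : ℝ) T → FracHJ.Vec n → FracHJ.Vec n → ℝ)
    (hH1 : Continuous fun q : Set.Icc (0 : ℝ) T × FracHJ.Vec n × FracHJ.Vec n =>
      H q.1 q.2.1 q.2.2)
    (cH : ℝ) (hcH : 0 < cH)
    (hH2 : ∀ t x s s', |H t x s - H t x s'| ≤ cH * (1 + ‖x‖) * ‖s - s'‖)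
    (hH3 : ∀ R : ℝ, 0 ≤ R → ∃ lH : ℝ, 0 < lH ∧ ∀ t x x' s, ‖x‖ ≤ R → ‖x'‖ ≤ R →
      |H t x s - H t x' s| ≤ lH * (1 + ‖s‖) * ‖x - x'‖)
    (σ : FracHJ.ACFun n hT α → ℝ) (hσ : Continuous σ)
    (φ : FracHJ.ACPath n T α → ℝ) (hφ : FracHJ.IsMinimaxSolution hT cH H σ φ)
    (p : FracHJ.ACPath n T α) (hp : (p.1.time : ℝ) < T)
    (a : ℝ) (v : FracHJ.Vec n) (hd : FracHJ.HasCiDerivAt hT φ p a v) :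
    a + H p.1.time p.endValue v = 0 := by
  have hL : Continuous fun q : ℝ × FracHJ.Vec n => H (Set.projIcc 0 T hT.le q.1) q.2 v :=
    hH1.comp (((continuous_projIcc (h := hT.le)).comp continuous_fst).prodMk
      (continuous_snd.prodMk continuous_const))
  have h1 := FracHJ.add_le_zero_of_isStable hα hcH
    (L := fun τ x => H (Set.projIcc 0 T hT.le τ) x v) hL hφ.1.lsc (hφ.1.isStable hα hL) hp hd
  -- For `-φ`, with `ci`-derivatives `-a` and `-v`, the inequality reads `-a - H ≤ 0`.
  have h2 := FracHJ.add_le_zero_of_isStable hα hcH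
    (L := fun τ x => -H (Set.projIcc 0 T hT.le τ) x v) hL.neg (fun q c hc => by
      filter_upwards [hφ.2.usc q (-c) (lt_neg.1 hc)] with r hr using lt_neg.1 hr)
    (hφ.2.isStable_neg hα hL) hp hd.neg
  rw [Set.projIcc_val] at h1 h2
  linarith
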